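/- **Setting.** A finite register $Q$ of qubits is coupled to a bath with arbitrary Hilbert space $\mathcal B$. The joint evolution during $[0,T]$ is governed by $H=H_S+H_B+H_{SB}$. The time-dependent system Hamiltonian $H_S$ realizes an ideal quantum circuit with a finite non-empty set of locations; each location (a gate, or an identity operation on an idle qubit) is executed on a set of qubits during a time interval $[a,b)\subseteq[0,T]$, and a qubit takes part in at most one location at a time. The bath Hamiltonian $H_B$ is an arbitrary (possibly unbounded, possibly time-dependent) self-adjoint operator that generates a strongly continuous unitary evolution of the bath. The system–bath coupling is $$H_{SB}(t)=\sum_{k\ge1}\frac1{k!}\sum_{i_1,\dots,i_k\in Q}H^{(k)}_{i_1,\dots,i_k}(t),$$ where $H^{(k)}_{i_1,\dots,i_k}(t)$ is bounded, self-adjoint, acts on the system qubits $i_1,\dots,i_k$ and arbitrarily on the bath, is invariant under permutations of the indices, and vanishes if two indices coincide. Let $t_0$ be the maximal duration of a location and, for $k\ge1$, $$\tilde\eta_1^{(k)}=\max_{i_1,\,t}\ \sum_{i_2,\dots,i_k}\big\|H^{(k)}_{i_1,i_2,\dots,i_k}(t)\big\|\,t_0 ,$$ the maximum being over all qubits $i_1$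 and all times $t\in[0,T]$. **Effective noise strength.** Expand the evolution operator $U$ over $[0,T]$ in powers of $H_{SB}$, to all orders (the time-ordered perturbation series about the evolution generated by $H_S+H_B$). For a set $\mathcal I_r$ of $r$ locations let $E(\mathcal I_r)$ be the sum of all terms of the expansion for which every location in $\mathcal I_r$ is faulty, i.e. at least one of the qubits at that location is struck at least once by a term of $H_{SB}$ while the location is executed. The noise has effective noise strength $\varepsilon$ if, for every $r$ and every set $\mathcal I_r$ of $r$ locations, the expansion defining $E(\mathcal I_r)$ converges strongly and $\|E(\mathcal I_r)\|\le\varepsilon^r$. **Theorem.** Suppose that each location acts on at most $m$ qubits and that, for some $\alpha\ge0$ and $f_1,f_2,\ldots\ge0$, $$\tilde\eta_1^{(k)}\le f_k\,\alpha^k\qquad\text{for all }k\ge1 .$$ Suppose also that the series $$g_k=\sum_{l=0}^\infty\frac{(k-1)!\,f_{k+l}\,(2\alpha)^l}{(k+l-1)!}\quad(k\ge1)\qquad\text{and}\qquad \sum_{k=1}^\infty\frac{g_k}{2\,k!}$$ converge. Then the noise has effective noise strength $\varepsilon$ with $$\varepsilon\le 2m\alpha\,\exp\Big(\sum_{k=1}^\infty\frac{g_k}{2\,k!}\Big),$$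 that is, $\|E(\mathcal I_r)\|\le\big(2m\alpha\exp(\sum_{k\ge1} g_k/(2\,k!))\big)^r$ for every set $\mathcal I_r$ of $r$ locations. -/

import Mathlib

open scoped ENNReal InnerProductSpace
open MeasureTheory

noncomputable section

namespace CorrelatedNoise

/-- Computational basis labels of a register of qubits `Q`. -/
abbrev Bits (Q : Type*) := Q → Fin 2

/-- The joint Hilbert space `(ℂ²)^{⊗ Q} ⊗ 𝓑` of the system qubits `Q` and the bath `𝓑`, realized
as the `ℓ²` direct sum of copies of `𝓑` indexed by the computational basis. -/
abbrev Joint (Q 𝓑 : Type*) := PiLp 2 (fun _ : Bits Q => 𝓑)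

/-- The operator on the joint space with bath-operator entries `A x y`, that is
`∑ x y, |x⟩⟨y| ⊗ A x y`. -/
def ofBlocks {Q 𝓑 : Type*} [Fintype Q] [DecidableEq Q]
    [NormedAddCommGroup 𝓑] [InnerProductSpace ℂ 𝓑]
    (A : Bits Q → Bits Q → (𝓑 →L[ℂ] 𝓑)) : Joint Q 𝓑 →L[ℂ] Joint Q 𝓑 :=
  (PiLp.continuousLinearEquiv 2 ℂ (fun _ : Bits Q => 𝓑)).symm.toContinuousLinearMap ∘L
    ContinuousLinearMap.pi (fun x => ∑ y, A x y ∘L PiLp.proj 2 (fun _ : Bits Q => 𝓑) y)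

lemma ofBlocks_apply {Q 𝓑 : Type*} [Fintype Q] [DecidableEq Q]
    [NormedAddCommGroup 𝓑] [InnerProductSpace ℂ 𝓑]
    (A : Bits Q → Bits Q → (𝓑 →L[ℂ] 𝓑)) (ψ : Joint Q 𝓑) (x : Bits Q) :
    ofBlocks A ψ x = ∑ y, A x y (ψ y) := by
  simp [ofBlocks]

/-- The array with entries `a x|_S y|_S` if `x` and `y` agree outside `S`, and `0` otherwise:
the array of the operator `a ⊗ 1`, where `a` acts on the qubits in `S` and `1` is the identity on
all other qubits. -/
def extendBlocks {Q R : Type*} [Fintype Q] [DecidableEq Q] [Zero R]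
    (S : Finset Q) (a : Bits S → Bits S → R) : Bits Q → Bits Q → R :=
  fun x y => if ∀ q, q ∉ S → x q = y q then a (fun q => x q) (fun q => y q) else 0

/-- A quantum circuit on the qubits `Q` with locations `Loc`, run during the time interval
`[0, T]`.  Location `ℓ` is an operation on the qubits `qubits ℓ` executed during the time interval
`[startTime ℓ, endTime ℓ)` by a Hamiltonian `gate ℓ` (an idle qubit being a location with
`gate ℓ = 0`). A qubit takes part in at most one operation at a time. -/
structure Circuit (Q Loc : Type*) [Fintype Q] [DecidableEq Q] where
  T : ℝ
  qubits : Loc → Finset Q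
  startTime : Loc → ℝ
  endTime : Loc → ℝ
  startTime_nonneg : ∀ ℓ, 0 ≤ startTime ℓ
  startTime_lt_endTime : ∀ ℓ, startTime ℓ < endTime ℓ
  endTime_le : ∀ ℓ, endTime ℓ ≤ T
  disjoint : ∀ ℓ ℓ', ℓ ≠ ℓ' → ¬ Disjoint (qubits ℓ) (qubits ℓ') →
    Disjoint (Set.Ico (startTime ℓ) (endTime ℓ)) (Set.Ico (startTime ℓ') (endTime ℓ'))
  gate : Loc → ℝ → Matrix (Bits Q) (Bits Q) ℂ
  gate_hermitian : ∀ ℓ t, (gate ℓ t).IsHermitian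
  gate_local : ∀ ℓ t, ∃ a : Bits (qubits ℓ) → Bits (qubits ℓ) → ℂ,
    gate ℓ t = extendBlocks (qubits ℓ) a
  gate_integrable : ∀ ℓ x y, LocallyIntegrable (fun t => gate ℓ t x y)

/-- The ideal system Hamiltonian `H_S(t)`: the sum of the Hamiltonians of the operations in
progress at time `t`. -/
def Circuit.hamiltonian {Q Loc : Type*} [Fintype Q] [DecidableEq Q] [Fintype Loc]
    (C : Circuit Q Loc) (t : ℝ) : Matrix (Bits Q) (Bits Q) ℂ :=
  ∑ ℓ, Set.indicator (Set.Ico (C.startTime ℓ) (C.endTime ℓ)) (C.gate ℓ) t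

/-- The maximal duration `t₀` of a location. -/
def Circuit.maxDuration {Q Loc : Type*} [Fintype Q] [DecidableEq Q] (C : Circuit Q Loc) : ℝ :=
  ⨆ ℓ, (C.endTime ℓ - C.startTime ℓ)

/-- `U t` is the unitary evolution operator from time `0` to time `t` of the finite-dimensional
system with Hamiltonian `H`: `i dU/dt = H U`, `U 0 = 1`, in integrated form. -/
structure IsSystemEvolution {Q : Type*} [Fintype Q] [DecidableEq Q]
    (H U : ℝ → Matrix (Bits Q) (Bits Q) ℂ) : Prop where
  unitary : ∀ t, U t ∈ Matrix.unitaryGroup (Bits Q) ℂ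
  continuous : Continuous U
  schrodinger : ∀ t x y,
    U t x y = (1 : Matrix (Bits Q) (Bits Q) ℂ) x y -
      Complex.I * ∫ τ in (0 : ℝ)..t, (H τ * U τ) x y

/-- `V t` is the (strongly continuous) unitary evolution operator from time `0` to time `t` of
the bath with possibly unbounded Hamiltonian `H`: the Schrödinger equation holds weakly, i.e. tested
against vectors `φ` in the domain of `H`.  For a time-independent self-adjoint `H` this says
`V t = exp(-i t H)`. -/
structure IsBathEvolution {𝓑 : Type*} [NormedAddCommGroup 𝓑] [InnerProductSpace ℂ 𝓑]
    [CompleteSpace 𝓑] (H : ℝ → 𝓑 →ₗ.[ℂ] 𝓑) (V : ℝ → 𝓑 →L[ℂ] 𝓑) : Prop where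
  unitary : ∀ t, V t ∈ unitary (𝓑 →L[ℂ] 𝓑)
  continuous : ∀ ψ, Continuous (fun t => V t ψ)
  zero : V 0 = 1
  schrodinger : ∀ (φ : 𝓑) (hφ : ∀ τ, φ ∈ (H τ).domain),
    LocallyIntegrable (fun τ => H τ ⟨φ, hφ τ⟩) → ∀ (ψ : 𝓑) (t : ℝ),
      ⟪φ, V t ψ⟫_ℂ = ⟪φ, ψ⟫_ℂ - Complex.I * ∫ τ in (0 : ℝ)..t, ⟪H τ ⟨φ, hφ τ⟩, V τ ψ⟫_ℂ

/-- A noisy quantum computation: an ideal circuit, a bath Hamiltonian `H_B` (arbitrary, possibly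
unbounded and time dependent), and the system-bath coupling
`H_SB(t) = ∑_{S ≠ ∅} coupling S t`, where the term labelled by the set `S` of qubits acts on these
qubits and arbitrarily on the bath. -/
structure NoisyComputation (Q Loc 𝓑 : Type*) [Fintype Q] [DecidableEq Q]
    [NormedAddCommGroup 𝓑] [InnerProductSpace ℂ 𝓑] [CompleteSpace 𝓑] extends Circuit Q Loc where
  bath : ℝ → 𝓑 →ₗ.[ℂ] 𝓑
  bath_selfAdjoint : ∀ t, IsSelfAdjoint (bath t)
  coupling : Finset Q → ℝ → (Joint Q 𝓑 →L[ℂ] Joint Q 𝓑)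
  coupling_selfAdjoint : ∀ S t, IsSelfAdjoint (coupling S t)
  coupling_local : ∀ (S : Finset Q) (t : ℝ), ∃ a : Bits S → Bits S → (𝓑 →L[ℂ] 𝓑),
    coupling S t = ofBlocks (extendBlocks S a)
  coupling_measurable : ∀ S ψ, StronglyMeasurable (fun t => coupling S t ψ)

section

variable {Q Loc 𝓑 : Type*} [Fintype Q] [DecidableEq Q]
  [NormedAddCommGroup 𝓑] [InnerProductSpace ℂ 𝓑] [CompleteSpace 𝓑]

/-- The term `H^{(k)}_{i₁, …, i_k}(t)` of the coupling: it is invariant under permutations of the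
indices and vanishes if two of them coincide. -/
def NoisyComputation.tupleCoupling (M : NoisyComputation Q Loc 𝓑) (k : ℕ) (i : Fin k → Q)
    (t : ℝ) : Joint Q 𝓑 →L[ℂ] Joint Q 𝓑 :=
  if Function.Injective i then M.coupling (Finset.univ.image i) t else 0

/-- The strength of the `k`-qubit terms,
`max_{i₁, t} ∑_{i₂, …, i_k} ‖H^{(k)}_{i₁, …, i_k}(t)‖ t₀`, for `k ≥ 1`. -/
def NoisyComputation.strength (M : NoisyComputation Q Loc 𝓑) : ℕ → ℝ≥0∞
  | 0 => 0
  | k + 1 => ⨆ (i₁ : Q) (t : Set.Icc (0 : ℝ) M.T),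
      ∑ j : Fin k → Q, ‖M.tupleCoupling (k + 1) (Fin.cons i₁ j) t‖ₑ * ENNReal.ofReal M.maxDuration

/-- The unperturbed evolution operator `U_S(t) ⊗ V_B(t)` generated by `H_S + H_B`. -/
def freeEvolution (U : ℝ → Matrix (Bits Q) (Bits Q) ℂ) (V : ℝ → 𝓑 →L[ℂ] 𝓑) (t : ℝ) :
    Joint Q 𝓑 →L[ℂ] Joint Q 𝓑 :=
  ofBlocks (fun x y => U t x y • V t)

/-- The coupling term `S` in the interaction picture defined by the free evolution `W`. -/
def NoisyComputation.interaction (M : NoisyComputation Q Loc 𝓑)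
    (W : ℝ → Joint Q 𝓑 →L[ℂ] Joint Q 𝓑) (S : Finset Q) (t : ℝ) : Joint Q 𝓑 →L[ℂ] Joint Q 𝓑 :=
  ContinuousLinearMap.adjoint (W t) ∘L M.coupling S t ∘L W t

/-- The contribution to the evolution operator over `[0, T]` in which the coupling terms
`S 0, …, S (n-1)` are inserted at the times `t 0 ≥ … ≥ t (n-1)`. -/
def NoisyComputation.insertions (M : NoisyComputation Q Loc 𝓑)
    (W : ℝ → Joint Q 𝓑 →L[ℂ] Joint Q 𝓑) {n : ℕ} (S : Fin n → {S : Finset Q // S.Nonempty})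
    (t : Fin n → ℝ) : Joint Q 𝓑 →L[ℂ] Joint Q 𝓑 :=
  W M.T * (List.ofFn (fun j => (-Complex.I) • M.interaction W (S j) (t j))).prod

/-- Time-ordered insertion times in `[0, T]`, the latest first. -/
def Circuit.orderedTimes (C : Circuit Q Loc) (n : ℕ) : Set (Fin n → ℝ) :=
  {t | Antitone t ∧ ∀ j, t j ∈ Set.Icc 0 C.T}

/-- The location `ℓ` is faulty: at least one of its qubits is struck at least once, by one of the
terms `S j` inserted at the times `t j`, while the operation at `ℓ` is executed. -/
def Circuit.IsFaulty (C : Circuit Q Loc) {n : ℕ} (S : Fin n → {S : Finset Q // S.Nonempty})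
    (t : Fin n → ℝ) (ℓ : Loc) : Prop :=
  ∃ j, t j ∈ Set.Ico (C.startTime ℓ) (C.endTime ℓ) ∧ ∃ q ∈ C.qubits ℓ, q ∈ (S j).1

/-- The region of insertion times of the terms `S 0, …, S (n-1)` for which every location in `I`
is faulty. -/
def Circuit.faultyTimes (C : Circuit Q Loc) (I : Finset Loc) {n : ℕ}
    (S : Fin n → {S : Finset Q // S.Nonempty}) : Set (Fin n → ℝ) :=
  {t | t ∈ C.orderedTimes n ∧ ∀ ℓ ∈ I, C.IsFaulty S t ℓ}

/-- `E = E(I)` is the sum, over all orders `n`, of all the terms in the expansion of the evolution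
operator in powers of the coupling such that every location in `I` is faulty.  The integrals and the
series converge in the strong sense. -/
structure NoisyComputation.IsFaultSum (M : NoisyComputation Q Loc 𝓑)
    (W : ℝ → Joint Q 𝓑 →L[ℂ] Joint Q 𝓑) (I : Finset Loc)
    (E : Joint Q 𝓑 →L[ℂ] Joint Q 𝓑) : Prop where
  integrable : ∀ (n : ℕ) (S : Fin n → {S : Finset Q // S.Nonempty}) (ψ : Joint Q 𝓑),
    IntegrableOn (fun t => M.insertions W S t ψ) (M.faultyTimes I S)
  hasSum : ∀ ψ : Joint Q 𝓑, HasSum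
    (fun n : ℕ => ∑ S : Fin n → {S : Finset Q // S.Nonempty},
      ∫ t in M.faultyTimes I S, M.insertions W S t ψ) (E ψ)

/-- The noise has effective noise strength `ε`: `‖E(I)‖ ≤ ε ^ r` for every set `I` of `r`
locations (in particular the expansion defining `E(I)` converges). -/
def NoisyComputation.HasEffectiveNoiseStrength (M : NoisyComputation Q Loc 𝓑)
    (W : ℝ → Joint Q 𝓑 →L[ℂ] Joint Q 𝓑) (ε : ℝ) : Prop :=
  ∀ I : Finset Loc, ∃ E : Joint Q 𝓑 →L[ℂ] Joint Q 𝓑, M.IsFaultSum W I E ∧ ‖E‖ ≤ ε ^ I.card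

end

/-- The `l`-th term `(k-1)! f_{k+l} (2α)^l / (k+l-1)!` of the series `g_k`, for `k ≥ 1`. -/
def gTerm (f : ℕ → ℝ) (α : ℝ) (k l : ℕ) : ℝ :=
  ((k - 1).factorial : ℝ) * f (k + l) * (2 * α) ^ l / ((k + l - 1).factorial : ℝ)

/-- `g_k = ∑_{l ≥ 0} (k-1)! f_{k+l} (2α)^l / (k+l-1)!`, for `k ≥ 1`. -/
def g (f : ℕ → ℝ) (α : ℝ) (k : ℕ) : ℝ := ∑' l : ℕ, gTerm f α k l

end CorrelatedNoise

end

noncomputable section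

namespace CorrelatedNoise

/-! In the interaction picture, split the evolved vector `ψ` into parts `Ψ_J(t)`, `J ⊆ I`, where `J`
is the set of locations of `I` struck so far. An insertion at time `s` that strikes the locations in
`mark` sends part `J'` to part `J' ∪ mark`, so the parts obey a closed linear evolution equation
(`gen`). Its perturbation series converges, since finitely many bounded operators occur, and equals
the sum of time-ordered integrals defining the expansion (`dyson_eq_sum_term`). Hence `E(I) ψ = W(T)
Ψ_I(T)`.

The bound is an energy estimate. In `d‖Ψ_J‖²/dt = 2 Re ⟪Ψ_J, Ψ_J'⟫` (prime for time derivative), the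
insertions that lead from `J` to `J` itself drop out because each operator is skew-adjoint. Only
insertions that make at least one new location faulty contribute (`re_inner_gen_le`). With the
weights `c ^ |J|`, the quantity `max_J (‖Ψ_J‖ / c ^ |J|)²` grows at rate at most `2γ(s)`, where
`γ(s)` bounds the sum, over coupling terms and over nonempty sets `B` of locations of `I` struck at
time `s`, of the norm times `c⁻¹ ^ |B|`. Grönwall gives `‖Ψ_J(T)‖ ≤ c ^ |J| exp(∫ γ) ‖ψ‖`
(`norm_evolution_le`).

Counting then shows that, for `c > 2mα`, `γ(s)` can be taken to be `κ / t₀` times the number of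
locations of `I` in progress, with `κ = ∑ g_k / (2 k!)` (`sum_mul_sum_powerset_le`). A location
lasts at most `t₀`, so `∫ γ ≤ |I| κ` and `‖E(I)‖ ≤ (c exp κ) ^ |I|`. Letting `c` decrease to `2mα`
finishes the proof. -/

lemma stronglyMeasurable_clm_apply {α E F : Type*} [MeasurableSpace α]
    [NormedAddCommGroup E] [NormedSpace ℂ E] [NormedAddCommGroup F] [NormedSpace ℂ F]
    {A : α → E →L[ℂ] F} (hA : ∀ v, StronglyMeasurable fun a => A a v)
    {φ : α → E} (hφ : StronglyMeasurable φ) : StronglyMeasurable fun a => A a (φ a) := by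
  -- `A` is measurable only vector by vector. On a simple function the composite is a finite sum
  -- over level sets; continuity of each `A a` then passes to the limit.
  have key : ∀ n, StronglyMeasurable fun a => A a (hφ.approx n a) := by
    intro n
    have h : (fun a => A a (hφ.approx n a)) = fun a =>
        ∑ y ∈ (hφ.approx n).range, (hφ.approx n ⁻¹' {y}).indicator (fun a => A a y) a := by
      funext a
      rw [Finset.sum_eq_single (hφ.approx n a)]
      · simp
      · intro y _ hy
        simp [Set.indicator, hy.symm]
      · intro h
        simp at h
    rw [h]
    exact Finset.stronglyMeasurable_fun_sum _ fun y _ =>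
      (hA y).indicator ((hφ.approx n).measurableSet_preimage _)
  exact stronglyMeasurable_of_tendsto Filter.atTop key
    (tendsto_pi_nhds.2 fun a => ((A a).continuous.tendsto _).comp (hφ.tendsto_approx a))

/-- A finite family of uniformly bounded, strongly measurable, time-dependent operators, in which
the operator `op i s` carries a set `mark i s` of labels. -/
structure MarkedFamily (ι L H : Type*) [NormedAddCommGroup H] [InnerProductSpace ℂ H] where
  op : ι → ℝ → H →L[ℂ] H
  mark : ι → ℝ → Finset L
  bound : ℝ
  op_measurable : ∀ i φ, StronglyMeasurable fun s => op i s φ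
  norm_op_le : ∀ i s, ‖op i s‖ ≤ bound
  mark_measurable : ∀ i ℓ, MeasurableSet {s | ℓ ∈ mark i s}

/-! ### Labelled perturbation series and time-ordered integrals. -/

namespace MarkedFamily

variable {ι L H : Type*} [Fintype ι] [Fintype L] [DecidableEq L]
  [NormedAddCommGroup H] [InnerProductSpace ℂ H]

/-- The generator of the evolution of a family of vectors labelled by the set of the labels that
have occurred so far. -/
def gen (X : MarkedFamily ι L H) (s : ℝ) (F : Finset L → H) (J : Finset L) : H :=
  ∑ i, ∑ J', if J' ∪ X.mark i s = J then X.op i s (F J') else 0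

/-- The `n`-th order term of the perturbation series of the evolution generated by `gen`. -/
def dyson (X : MarkedFamily ι L H) (ψ : H) : ℕ → Finset L → ℝ → H
  | 0, J, _ => if J = ∅ then ψ else 0
  | n + 1, J, t => ∫ s in (0 : ℝ)..t, X.gen s (fun J' => X.dyson ψ n J' s) J

omit [Fintype ι] in
lemma measurableSet_mark (X : MarkedFamily ι L H) (i : ι) (J J' : Finset L) :
    MeasurableSet {s | J' ∪ X.mark i s = J} := by
  have : {s | J' ∪ X.mark i s = J} = ⋂ ℓ, {s | (ℓ ∈ J' ∨ ℓ ∈ X.mark i s) ↔ ℓ ∈ J} := by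
    ext s
    simp [Finset.ext_iff]
  rw [this]
  refine MeasurableSet.iInter fun ℓ => ?_
  have h := X.mark_measurable i ℓ
  by_cases h1 : ℓ ∈ J' <;> by_cases h2 : ℓ ∈ J <;> simp only [h1, h2, true_or, false_or, iff_true,
    iff_false, not_true, MeasurableSet.const]
  · exact h
  · exact h.compl

lemma gen_stronglyMeasurable (X : MarkedFamily ι L H) {F : Finset L → ℝ → H}
    (hF : ∀ J, StronglyMeasurable (F J)) (J : Finset L) :
    StronglyMeasurable fun s => X.gen s (fun J' => F J' s) J := by
  classical
  refine Finset.stronglyMeasurable_fun_sum _ fun i _ =>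
    Finset.stronglyMeasurable_fun_sum _ fun J' _ => ?_
  exact StronglyMeasurable.ite (X.measurableSet_mark i J J')
    (stronglyMeasurable_clm_apply (X.op_measurable i) (hF J')) stronglyMeasurable_const

omit [Fintype ι] [Fintype L] [DecidableEq L] in
lemma bound_nonneg (X : MarkedFamily ι L H) (i : ι) : 0 ≤ X.bound :=
  (norm_nonneg _).trans (X.norm_op_le i 0)

lemma norm_gen_le (X : MarkedFamily ι L H) (s : ℝ) (F : Finset L → H) (J : Finset L) :
    ‖X.gen s F J‖ ≤ Fintype.card ι * X.bound * ∑ J', ‖F J'‖ := by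
  calc ‖X.gen s F J‖ ≤ ∑ _i : ι, X.bound * ∑ J', ‖F J'‖ := by
        refine norm_sum_le_of_le _ fun i _ => ?_
        rw [Finset.mul_sum]
        refine norm_sum_le_of_le _ fun J' _ => ?_
        have hb := X.bound_nonneg i
        split_ifs
        · exact (X.op i s).le_of_opNorm_le (X.norm_op_le i s) _
        · rw [norm_zero]; positivity
    _ = _ := by simp [mul_assoc]

lemma gen_intervalIntegrable (X : MarkedFamily ι L H) {F : Finset L → ℝ → H}
    (hF : ∀ J, Continuous (F J)) (J : Finset L) (a b : ℝ) :
    IntervalIntegrable (fun s => X.gen s (fun J' => F J' s) J) volume a b := by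
  have hc : Continuous fun s => Fintype.card ι * X.bound * ∑ J', ‖F J' s‖ := by fun_prop
  refine (hc.intervalIntegrable a b).mono_fun
    (gen_stronglyMeasurable X ?_ J).aestronglyMeasurable ?_
  · exact fun J => (hF J).stronglyMeasurable
  · exact Filter.Eventually.of_forall fun s =>
      (X.norm_gen_le s _ J).trans (le_abs_self _)

lemma dyson_continuous (X : MarkedFamily ι L H) (ψ : H) (n : ℕ) (J : Finset L) :
    Continuous (X.dyson ψ n J) := by
  induction n generalizing J with
  | zero => exact continuous_const
  | succ n ih =>
    exact intervalIntegral.continuous_primitive (fun a b => X.gen_intervalIntegrable ih J a b) 0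

/-- A bound on the norm of `gen` with respect to the supremum norm. -/
def rate (X : MarkedFamily ι L H) : ℝ :=
  Fintype.card ι * X.bound * Fintype.card (Finset L)

omit [Fintype L] [DecidableEq L] in
lemma card_mul_bound_nonneg (X : MarkedFamily ι L H) : 0 ≤ Fintype.card ι * X.bound := by
  rcases isEmpty_or_nonempty ι with h | ⟨⟨i⟩⟩
  · simp
  · exact mul_nonneg (Nat.cast_nonneg _) (X.bound_nonneg i)

omit [DecidableEq L] in
lemma rate_nonneg (X : MarkedFamily ι L H) : 0 ≤ X.rate :=
  mul_nonneg X.card_mul_bound_nonneg (Nat.cast_nonneg _)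

lemma norm_gen_le_rate (X : MarkedFamily ι L H) (s : ℝ) {F : Finset L → H} {C : ℝ}
    (hF : ∀ J, ‖F J‖ ≤ C) (J : Finset L) : ‖X.gen s F J‖ ≤ X.rate * C := by
  refine (X.norm_gen_le s F J).trans ?_
  rw [rate, mul_assoc _ _ C]
  refine mul_le_mul_of_nonneg_left ?_ X.card_mul_bound_nonneg
  simpa [Finset.card_univ] using Finset.sum_le_sum fun J (_ : J ∈ Finset.univ) => hF J

lemma norm_dyson_le (X : MarkedFamily ι L H) (ψ : H) (n : ℕ) (J : Finset L) {t : ℝ} (ht : 0 ≤ t) :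
    ‖X.dyson ψ n J t‖ ≤ (X.rate * t) ^ n / n.factorial * ‖ψ‖ := by
  induction n generalizing J t with
  | zero =>
    simp only [dyson, pow_zero, Nat.factorial_zero, Nat.cast_one, div_one, one_mul]
    split_ifs <;> simp
  | succ n ih =>
    simp only [dyson]
    have h1 : ∀ s ∈ Set.Ioc 0 t, ‖X.gen s (fun J' => X.dyson ψ n J' s) J‖ ≤
        X.rate ^ (n + 1) / n.factorial * ‖ψ‖ * s ^ n := by
      intro s hs
      refine (X.norm_gen_le_rate s (fun J' => ih J' hs.1.le) J).trans (le_of_eq ?_)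
      rw [mul_pow]; ring
    refine (intervalIntegral.norm_integral_le_of_norm_le ht (Filter.Eventually.of_forall h1)
      (Continuous.intervalIntegrable (by fun_prop) _ _)).trans (le_of_eq ?_)
    rw [intervalIntegral.integral_const_mul, integral_pow, Nat.factorial_succ]
    push_cast
    rw [mul_pow]
    field_simp
    simp

/-- The set of the labels of the operators `S 0, …, S (n-1)` at the times `p 0, …, p (n-1)`. -/
def marks (X : MarkedFamily ι L H) {n : ℕ} (S : Fin n → ι) (p : Fin n → ℝ) : Finset L :=
  Finset.univ.biUnion fun j => X.mark (S j) (p j)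

/-- The time-ordered tuples of times in `[0, t]`, the latest first, at which the operators `S` carry
the set of labels `J`. -/
def region (X : MarkedFamily ι L H) {n : ℕ} (S : Fin n → ι) (J : Finset L) (t : ℝ) :
    Set (Fin n → ℝ) :=
  {p | (Antitone p ∧ ∀ j, p j ∈ Set.Icc 0 t) ∧ X.marks S p = J}

/-- The product of the operators `S` at the times `p`. -/
def product (X : MarkedFamily ι L H) {n : ℕ} (S : Fin n → ι) (p : Fin n → ℝ) : H →L[ℂ] H :=
  (List.ofFn fun j => X.op (S j) (p j)).prod

omit [Fintype ι] [Fintype L] [DecidableEq L] in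
lemma product_cons (X : MarkedFamily ι L H) {n : ℕ} (i : ι) (S : Fin n → ι) (s : ℝ)
    (p : Fin n → ℝ) :
    X.product (Fin.cons i S : Fin (n + 1) → ι) (Fin.cons s p) = X.op i s * X.product S p := by
  simp [product, List.ofFn_succ]

omit [Fintype ι] [Fintype L] in
lemma marks_cons (X : MarkedFamily ι L H) {n : ℕ} (i : ι) (S : Fin n → ι) (s : ℝ)
    (p : Fin n → ℝ) :
    X.marks (Fin.cons i S : Fin (n + 1) → ι) (Fin.cons s p) = X.marks S p ∪ X.mark i s := by
  ext ℓ
  simp [marks, Fin.exists_fin_succ, or_comm]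

omit [Fintype ι] [Fintype L] [DecidableEq L] in
lemma product_stronglyMeasurable (X : MarkedFamily ι L H) {n : ℕ} (S : Fin n → ι) (ψ : H) :
    StronglyMeasurable fun p => X.product S p ψ := by
  induction n with
  | zero => simp [product]
  | succ n ih =>
    have h : (fun p => X.product S p ψ) = fun p : Fin (n + 1) → ℝ =>
        X.op (S 0) (p 0) (X.product (Fin.tail S) (Fin.tail p) ψ) := by
      funext p
      conv_lhs => rw [← Fin.cons_self_tail S, ← Fin.cons_self_tail p, product_cons]
      rfl
    rw [h]
    refine stronglyMeasurable_clm_apply (fun v => ?_) ?_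
    · exact (X.op_measurable (S 0) v).comp_measurable (measurable_pi_apply 0)
    · exact (ih (Fin.tail S)).comp_measurable
        (measurable_pi_lambda _ fun j => measurable_pi_apply j.succ)

omit [Fintype ι] [Fintype L] [DecidableEq L] in
lemma norm_product_le (X : MarkedFamily ι L H) {n : ℕ} (S : Fin n → ι) (p : Fin n → ℝ) :
    ‖X.product S p‖ ≤ X.bound ^ n := by
  induction n with
  | zero =>
    simp only [product, List.ofFn_zero, List.prod_nil, pow_zero]
    exact ContinuousLinearMap.norm_id_le
  | succ n ih =>
    rw [← Fin.cons_self_tail S, ← Fin.cons_self_tail p, product_cons, pow_succ']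
    exact (norm_mul_le _ _).trans (mul_le_mul (X.norm_op_le _ _) (ih _ _) (norm_nonneg _)
      ((norm_nonneg _).trans (X.norm_op_le (S 0) 0)))

omit [Fintype ι] in
lemma measurableSet_region (X : MarkedFamily ι L H) {n : ℕ} (S : Fin n → ι) (J : Finset L)
    (t : ℝ) : MeasurableSet (X.region S J t) := by
  refine MeasurableSet.inter ?_ ?_
  · have : IsClosed {p : Fin n → ℝ | Antitone p ∧ ∀ j, p j ∈ Set.Icc 0 t} := by
      simp only [Antitone, Set.ofPred_and, Set.ofPred_forall]
      refine IsClosed.inter ?_ ?_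
      · exact isClosed_iInter fun a => isClosed_iInter fun b => isClosed_iInter fun _ =>
          isClosed_le (continuous_apply _) (continuous_apply _)
      · exact isClosed_iInter fun a => isClosed_Icc.preimage (continuous_apply a)
    exact this.measurableSet
  · have : {p | X.marks S p = J} = ⋂ ℓ, {p | (∃ j, ℓ ∈ X.mark (S j) (p j)) ↔ ℓ ∈ J} := by
      ext p
      simp [marks, Finset.ext_iff]
    change MeasurableSet {p | X.marks S p = J}
    rw [this]
    refine MeasurableSet.iInter fun ℓ => ?_
    have h : MeasurableSet {p : Fin n → ℝ | ∃ j, ℓ ∈ X.mark (S j) (p j)} := by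
      rw [Set.ofPred_exists]
      exact MeasurableSet.iUnion fun j => (X.mark_measurable (S j) ℓ).preimage
        (measurable_pi_apply j)
    by_cases h2 : ℓ ∈ J
    · simpa only [h2, iff_true] using h
    · simp only [h2, iff_false]
      exact h.compl

omit [Fintype ι] [Fintype L] in
lemma volume_region_lt_top (X : MarkedFamily ι L H) {n : ℕ} (S : Fin n → ι) (J : Finset L)
    (t : ℝ) : volume (X.region S J t) < ∞ := by
  refine (measure_mono (t := Set.Icc (fun _ => 0) (fun _ => t)) ?_).trans_lt
    (isCompact_Icc.measure_lt_top)
  intro p hp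
  exact ⟨fun j => (hp.1.2 j).1, fun j => (hp.1.2 j).2⟩

omit [Fintype ι] [Fintype L] in
lemma integrableOn_product (X : MarkedFamily ι L H) {n : ℕ} (S : Fin n → ι) (J : Finset L)
    (t : ℝ) (ψ : H) : IntegrableOn (fun p => X.product S p ψ) (X.region S J t) := by
  refine Measure.integrableOn_of_bounded (M := X.bound ^ n * ‖ψ‖)
    (X.volume_region_lt_top S J t).ne (X.product_stronglyMeasurable S ψ).aestronglyMeasurable ?_
  exact Filter.Eventually.of_forall fun p =>
    (X.product S p).le_of_opNorm_le (X.norm_product_le S p) _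

omit [Fintype ι] [Fintype L] in
-- Peels off the latest time `s`: the order constraint confines the earlier times to `[0, s]`, and
-- their own label set is the `J'` of `gen`.
lemma cons_mem_region (X : MarkedFamily ι L H) {n : ℕ} (i : ι) (S : Fin n → ι) (J : Finset L)
    (t s : ℝ) (q : Fin n → ℝ) :
    (Fin.cons s q : Fin (n + 1) → ℝ) ∈ X.region (Fin.cons i S : Fin (n + 1) → ι) J t ↔
      s ∈ Set.Icc 0 t ∧ q ∈ X.region S (X.marks S q) s ∧ X.marks S q ∪ X.mark i s = J := by
  simp only [region, Set.mem_ofPred_eq, marks_cons, and_true]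
  rw [← and_assoc]
  refine and_congr_left fun _ => ?_
  constructor
  · rintro ⟨h1, h2⟩
    refine ⟨by simpa using h2 0, fun a b hab => ?_, fun j => ⟨by simpa using (h2 j.succ).1, ?_⟩⟩
    · simpa using h1 (Fin.succ_le_succ_iff.2 hab)
    · simpa using h1 (Fin.zero_le j.succ)
  · rintro ⟨h1, h2, h3⟩
    refine ⟨fun a b hab => ?_, fun j => ?_⟩
    · induction a using Fin.cases with
      | zero =>
        induction b using Fin.cases with
        | zero => exact le_rfl
        | succ b => simpa using (h3 b).2
      | succ a =>
        induction b using Fin.cases with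
        | zero => exact absurd hab (by simp)
        | succ b => simpa using h2 (Fin.succ_le_succ_iff.1 hab)
    · induction j using Fin.cases with
      | zero => simpa using h1
      | succ j => simpa using ⟨(h3 j).1, (h3 j).2.trans h1.2⟩

/-- The integral of `product` over `region`. -/
def term (X : MarkedFamily ι L H) (ψ : H) {n : ℕ} (S : Fin n → ι) (J : Finset L) (t : ℝ) : H :=
  ∫ p in X.region S J t, X.product S p ψ

omit [Fintype ι] in
lemma integral_indicator_region_cons [CompleteSpace H] (X : MarkedFamily ι L H) (ψ : H) {n : ℕ}
    (i : ι) (S : Fin n → ι) (J : Finset L) (t s : ℝ) :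
    ∫ q : Fin n → ℝ, (X.region (Fin.cons i S : Fin (n + 1) → ι) J t).indicator
        (fun p => X.product (Fin.cons i S : Fin (n + 1) → ι) p ψ) (Fin.cons s q) =
      (Set.Icc 0 t).indicator
        (fun s => ∑ J', if J' ∪ X.mark i s = J then X.op i s (X.term ψ S J' s) else 0) s := by
  classical
  by_cases hs : s ∈ Set.Icc 0 t
  · rw [Set.indicator_of_mem hs]
    have h : ∀ q : Fin n → ℝ, (X.region (Fin.cons i S : Fin (n + 1) → ι) J t).indicator
        (fun p => X.product (Fin.cons i S : Fin (n + 1) → ι) p ψ) (Fin.cons s q) =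
        ∑ J', if J' ∪ X.mark i s = J then
          (X.region S J' s).indicator (fun q => X.op i s (X.product S q ψ)) q else 0 := by
      intro q
      -- The regions for different `J'` are disjoint: a tuple `q` belongs only to the one indexed by
      -- its own label set.
      rw [Finset.sum_eq_single (X.marks S q)]
      · rw [Set.indicator_apply, cons_mem_region, Set.indicator_apply, product_cons]
        simp only [hs, true_and]
        split_ifs <;> first | rfl | tauto
      · intro J' _ hJ'
        rw [Set.indicator_of_notMem (fun h => hJ' h.2.symm), ite_self]
      · simp
    simp only [h]
    have hint : ∀ J', Integrable fun q : Fin n → ℝ => if J' ∪ X.mark i s = J then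
          (X.region S J' s).indicator (fun q => X.op i s (X.product S q ψ)) q else 0 := by
      intro J'
      split_ifs
      · exact IntegrableOn.integrable_indicator
          ((X.op i s).integrable_comp (X.integrableOn_product S J' s ψ))
          (X.measurableSet_region S J' s)
      · exact integrable_zero _ _ _
    rw [integral_finsetSum _ fun J' _ => hint J']
    refine Finset.sum_congr rfl fun J' _ => ?_
    split_ifs
    · rw [integral_indicator (X.measurableSet_region S J' s), term,
        (X.op i s).integral_comp_comm (X.integrableOn_product S J' s ψ)]
    · simp
  · rw [Set.indicator_of_notMem hs]
    refine integral_eq_zero_of_ae (Filter.Eventually.of_forall fun q => ?_)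
    exact Set.indicator_of_notMem (fun h => hs ((X.cons_mem_region i S J t s q).1 h).1) _

omit [Fintype ι] in
-- Fubini in the latest time. Integrability in `s` also comes from Fubini and is recorded because
-- `dyson_eq_sum_term` must exchange finite sums with this integral.
lemma term_cons [CompleteSpace H] (X : MarkedFamily ι L H) (ψ : H) {n : ℕ} (i : ι)
    (S : Fin n → ι) (J : Finset L) (t : ℝ) :
    IntegrableOn (fun s => ∑ J', if J' ∪ X.mark i s = J then X.op i s (X.term ψ S J' s) else 0)
        (Set.Icc 0 t) ∧
      X.term ψ (Fin.cons i S : Fin (n + 1) → ι) J t =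
        ∫ s in Set.Icc 0 t, ∑ J', if J' ∪ X.mark i s = J then X.op i s (X.term ψ S J' s) else 0 := by
  set F : (Fin (n + 1) → ℝ) → H := (X.region (Fin.cons i S : Fin (n + 1) → ι) J t).indicator
    (fun p => X.product (Fin.cons i S : Fin (n + 1) → ι) p ψ) with hF
  have hFi : Integrable F := (X.integrableOn_product _ J t ψ).integrable_indicator
    (X.measurableSet_region _ J t)
  have hmp := (volume_preserving_piFinSuccAbove (fun _ : Fin (n + 1) => ℝ) 0).symm
  have hcons : F ∘ (MeasurableEquiv.piFinSuccAbove (fun _ : Fin (n + 1) => ℝ) 0).symm =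
      fun z : ℝ × (Fin n → ℝ) => F (Fin.cons z.1 z.2) := by
    funext z
    simp [MeasurableEquiv.piFinSuccAbove, Fin.insertNthEquiv]
  have hG : Integrable (fun z : ℝ × (Fin n → ℝ) => F (Fin.cons z.1 z.2))
      (volume.prod volume) := by
    exact (hcons ▸ hmp.integrable_comp_of_integrable hFi :)
  have h1 : X.term ψ (Fin.cons i S : Fin (n + 1) → ι) J t =
      ∫ z : ℝ × (Fin n → ℝ), F (Fin.cons z.1 z.2) ∂(volume.prod volume) := by
    rw [term, ← integral_indicator (X.measurableSet_region _ J t), ← hF]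
    rw [← hmp.integral_comp (MeasurableEquiv.measurableEmbedding _), ← hcons]
    rfl
  have h2 := hG.integral_prod_left
  simp only [hF, integral_indicator_region_cons] at h2
  refine ⟨(integrable_indicator_iff measurableSet_Icc).1 h2, ?_⟩
  rw [h1, integral_prod _ hG, ← integral_indicator measurableSet_Icc]
  simp only [hF, integral_indicator_region_cons]

/-- Connects the recursive form, suited to differential estimates, with the integrals over ordered
tuples used to define `E(I)`. Both sides are built up by adding a latest insertion. -/
lemma dyson_eq_sum_term [CompleteSpace H] (X : MarkedFamily ι L H) (ψ : H) (n : ℕ) (J : Finset L)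
    {t : ℝ} (ht : 0 ≤ t) : X.dyson ψ n J t = ∑ S : Fin n → ι, X.term ψ S J t := by
  induction n generalizing J t with
  | zero =>
    simp only [dyson, term, Finset.univ_unique, Finset.sum_singleton]
    have h : X.region (default : Fin 0 → ι) J t = if J = ∅ then Set.univ else ∅ := by
      ext p
      have : Antitone p := fun a => a.elim0
      split_ifs with h <;> simp [region, marks, this, h, eq_comm]
    rw [h]
    split_ifs
    · simp [product, volume_pi, Measure.real]
    · simp
  | succ n ih =>
    rw [← (Fin.consEquiv fun _ : Fin (n + 1) => ι).sum_comp, Fintype.sum_prod_type]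
    simp only [Fin.consEquiv, Equiv.coe_fn_mk, (X.term_cons ψ _ _ J t).2]
    have hi := fun i (S : Fin n → ι) => (X.term_cons ψ i S J t).1
    have h1 : ∀ i, ∑ S : Fin n → ι, ∫ s in Set.Icc 0 t,
        (∑ J', if J' ∪ X.mark i s = J then X.op i s (X.term ψ S J' s) else 0) =
        ∫ s in Set.Icc 0 t, ∑ S : Fin n → ι,
          (∑ J', if J' ∪ X.mark i s = J then X.op i s (X.term ψ S J' s) else 0) :=
      fun i => (integral_finsetSum _ fun S _ => hi i S).symm
    simp only [h1]
    rw [← integral_finsetSum _ fun i _ => integrable_finsetSum _ fun S _ => hi i S]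
    rw [dyson, intervalIntegral.integral_of_le ht, ← integral_Icc_eq_integral_Ioc]
    refine setIntegral_congr_fun measurableSet_Icc fun s hs => ?_
    simp only [gen]
    refine Finset.sum_congr rfl fun i _ => ?_
    rw [Finset.sum_comm]
    refine Finset.sum_congr rfl fun J' _ => ?_
    rw [ih J' hs.1]
    split_ifs
    · rw [map_sum]
    · simp

end MarkedFamily

/-! ### Integral inequalities. -/

/-- Grönwall's inequality in integral form, for a right-continuous coefficient. -/
lemma le_mul_exp_integral {M γ : ℝ → ℝ} {T C : ℝ} (hM : ContinuousOn M (Set.Icc 0 T))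
    (hγ : ∀ s, ContinuousWithinAt γ (Set.Ici s) s) (hγ0 : ∀ s, 0 ≤ γ s) (hγm : Measurable γ)
    (hγi : ∀ a b, IntervalIntegrable γ volume a b)
    (h : ∀ t ∈ Set.Icc 0 T, M t ≤ C + ∫ s in (0 : ℝ)..t, γ s * M s) :
    ∀ t ∈ Set.Icc 0 T, M t ≤ C * Real.exp (∫ s in (0 : ℝ)..t, γ s) := by
  have hint : ∀ t ∈ Set.Icc 0 T, IntervalIntegrable (fun s => γ s * M s) volume 0 t := by
    intro t ht
    refine (hγi 0 t).mul_continuousOn (hM.mono ?_)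
    rw [Set.uIcc_of_le ht.1]
    exact Set.Icc_subset_Icc_right ht.2
  set R : ℝ → ℝ := fun t => C + ∫ s in (0 : ℝ)..t, γ s * M s with hR
  set Γ : ℝ → ℝ := fun t => ∫ s in (0 : ℝ)..t, γ s with hΓ
  -- Right-continuity of `γ` makes its primitive right-differentiable at every point, although the
  -- `γ` used later jumps at the start and end of locations.
  have hΓd : ∀ t, HasDerivWithinAt Γ (γ t) (Set.Ici t) t := fun t =>
    intervalIntegral.integral_hasDerivWithinAt_right (hγi 0 t)
      (hγm.stronglyMeasurable.stronglyMeasurableAtFilter)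
      ((hγ t).mono Set.Ioi_subset_Ici_self)
  have hRd : ∀ t ∈ Set.Ico 0 T, HasDerivWithinAt R (γ t * M t) (Set.Ici t) t := by
    intro t ht
    have hnh : Set.Icc 0 T ∈ nhdsWithin t (Set.Ioi t) :=
      Filter.mem_of_superset (Ioc_mem_nhdsGT ht.2) fun x hx => ⟨ht.1.trans hx.1.le, hx.2⟩
    refine HasDerivWithinAt.const_add C
      (intervalIntegral.integral_hasDerivWithinAt_right (hint t ⟨ht.1, ht.2.le⟩) ?_ ?_)
    · exact ⟨Set.Icc 0 T, hnh, (hγm.stronglyMeasurable.aestronglyMeasurable).mul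
        (hM.aestronglyMeasurable measurableSet_Icc)⟩
    · exact ((hγ t).mono Set.Ioi_subset_Ici_self).mul
        ((hM t ⟨ht.1, ht.2.le⟩).mono_of_mem_nhdsWithin hnh)
  have hRc : ContinuousOn R (Set.Icc 0 T) := by
    by_cases hT : 0 ≤ T
    · refine continuousOn_const.add ?_
      have := intervalIntegral.continuousOn_primitive_interval
        (μ := volume) (f := fun s => γ s * M s) (a := 0) (b := T) ?_
      · rwa [Set.uIcc_of_le hT] at this
      · rw [Set.uIcc_of_le hT, integrableOn_Icc_iff_integrableOn_Ioc]
        exact (hint T ⟨hT, le_rfl⟩).1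
    · rw [Set.Icc_eq_empty hT]
      exact continuousOn_empty _
  have hΓc : Continuous Γ := intervalIntegral.continuous_primitive hγi 0
  -- The right derivative of `R exp(-Γ)` is `γ (M - R) exp(-Γ) ≤ 0`, and its initial value is `C`.
  have key := image_le_of_deriv_right_le_deriv_boundary (f := fun t => R t * Real.exp (-Γ t))
    (f' := fun t => γ t * M t * Real.exp (-Γ t) + R t * (Real.exp (-Γ t) * -γ t))
    (B := fun _ => C) (B' := fun _ => 0) (a := 0) (b := T)
    (hRc.mul (by fun_prop)) (fun t ht => (hRd t ht).mul (hΓd t).neg.exp)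
    (by simp [hR, hΓ]) continuousOn_const (fun t _ => hasDerivWithinAt_const _ _ _) ?_
  · intro t ht
    refine (h t ht).trans ?_
    have := key ht
    simp only [Real.exp_neg] at this
    rwa [← div_eq_mul_inv, div_le_iff₀ (Real.exp_pos _)] at this
  · intro t ht
    have := mul_le_mul_of_nonneg_left (h t ⟨ht.1, ht.2.le⟩) (hγ0 t)
    nlinarith [mul_le_mul_of_nonneg_right this (Real.exp_pos (-Γ t)).le]

/-- The energy estimate for the squared norm of a primitive of `v`. -/
lemma norm_sq_le_add_integral {E : Type*} [NormedAddCommGroup E] [InnerProductSpace ℂ E]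
    [CompleteSpace E] {u v : ℝ → E} {w : ℝ → ℝ} {u₀ : E} {T C : ℝ} (hT : 0 ≤ T)
    (hv : IntervalIntegrable v volume 0 T) (hC : ∀ s ∈ Set.Icc 0 T, ‖v s‖ ≤ C)
    (hu : ∀ t ∈ Set.Icc 0 T, u t = u₀ + ∫ s in (0 : ℝ)..t, v s)
    (hw : IntervalIntegrable w volume 0 T)
    (h : ∀ s ∈ Set.Icc 0 T, 2 * (⟪u s, v s⟫_ℂ).re ≤ w s) :
    ‖u T‖ ^ 2 ≤ ‖u₀‖ ^ 2 + ∫ s in (0 : ℝ)..T, w s := by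
  set y : ℝ → E := fun t => u₀ + ∫ s in (0 : ℝ)..t, v s with hy
  have hC0 : 0 ≤ C := (norm_nonneg _).trans (hC 0 ⟨le_rfl, hT⟩)
  -- `v` is merely measurable and bounded, so `‖y‖²` is differentiable only almost everywhere. The
  -- Lipschitz bound gives absolute continuity, which is what recovers `‖y‖²` from its derivative.
  have hlip : LipschitzOnWith (Real.toNNReal C) (fun t => ‖y t‖) (Set.uIcc 0 T) := by
    rw [Set.uIcc_of_le hT]
    refine LipschitzOnWith.of_dist_le_mul fun a ha b hb => ?_
    rw [Real.coe_toNNReal _ hC0, Real.dist_eq, Real.dist_eq]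
    refine (abs_norm_sub_norm_le _ _).trans ?_
    have hsub : ∀ t ∈ Set.Icc 0 T, IntervalIntegrable v volume 0 t := fun t ht =>
      hv.mono_set (by
        rw [Set.uIcc_of_le hT, Set.uIcc_of_le ht.1]; exact Set.Icc_subset_Icc_right ht.2)
    simp only [hy, add_sub_add_left_eq_sub]
    rw [intervalIntegral.integral_interval_sub_left (hsub a ha) (hsub b hb)]
    refine intervalIntegral.norm_integral_le_of_norm_le_const fun s hs => hC s ?_
    have := Set.uIoc_subset_uIcc hs
    exact Set.uIcc_subset_Icc hb ha this
  have hac : AbsolutelyContinuousOnInterval (fun t => ‖y t‖ * ‖y t‖) 0 T :=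
    hlip.absolutelyContinuousOnInterval.mul hlip.absolutelyContinuousOnInterval
  have hint := hac.integral_deriv_eq_sub
  have hder : ∀ᵐ t, t ∈ Set.uIcc 0 T →
      HasDerivAt (fun t => ‖y t‖ * ‖y t‖) (2 * (⟪y t, v t⟫_ℂ).re) t := by
    filter_upwards [hv.ae_hasDerivAt_integral] with t ht htT
    have h1 : HasDerivAt y (v t) t := (ht htT 0 Set.left_mem_uIcc).const_add u₀
    have h2 := (Complex.reCLM.hasFDerivAt.comp_hasDerivAt t (h1.inner ℂ h1))
    refine (h2.congr_deriv ?_).congr_of_eventuallyEq (Filter.Eventually.of_forall fun s => ?_)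
    rotate_left
    · rw [Function.comp_apply, Complex.reCLM_apply, inner_self_eq_norm_sq_to_K]
      simp [sq]
    · simp only [Complex.reCLM_apply, Complex.add_re]
      rw [← inner_conj_symm (v t) (y t), Complex.conj_re]
      ring
  have hmono : ∫ s in (0 : ℝ)..T, deriv (fun t => ‖y t‖ * ‖y t‖) s ≤ ∫ s in (0 : ℝ)..T, w s := by
    refine intervalIntegral.integral_mono_ae_restrict hT hac.intervalIntegrable_deriv hw ?_
    rw [Filter.EventuallyLE, ae_restrict_iff' measurableSet_Icc]
    filter_upwards [hder] with t ht htT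
    rw [(ht (by rwa [Set.uIcc_of_le hT])).deriv]
    have := h t htT
    rwa [hu t htT] at this
  have h0 : y 0 = u₀ := by simp [hy]
  have h1 : u T = y T := hu T ⟨hT, le_rfl⟩
  simp only [h0, ← h1] at hint
  nlinarith

/-! ### The labelled evolution and its energy estimate. -/

namespace MarkedFamily

variable {ι L H : Type*} [Fintype ι] [Fintype L] [DecidableEq L]
  [NormedAddCommGroup H] [InnerProductSpace ℂ H]

/-- The sum of the perturbation series: the part of the evolved vector `ψ` with the labels `J`. -/
def evolution (X : MarkedFamily ι L H) (ψ : H) (J : Finset L) (t : ℝ) : H :=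
  ∑' n, X.dyson ψ n J t

omit [DecidableEq L] in
lemma summable_rate (X : MarkedFamily ι L H) (ψ : H) (t : ℝ) :
    Summable fun n : ℕ => (X.rate * t) ^ n / n.factorial * ‖ψ‖ :=
  (Real.summable_pow_div_factorial _).mul_right _

variable [CompleteSpace H]

lemma hasSum_dyson (X : MarkedFamily ι L H) (ψ : H) (J : Finset L) {t : ℝ} (ht : 0 ≤ t) :
    HasSum (fun n => X.dyson ψ n J t) (X.evolution ψ J t) :=
  ((X.summable_rate ψ t).of_norm_bounded fun n => X.norm_dyson_le ψ n J ht).hasSum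

omit [CompleteSpace H] in
lemma norm_dyson_le_of_le (X : MarkedFamily ι L H) (ψ : H) (n : ℕ) (J : Finset L) {s t : ℝ}
    (hs : s ∈ Set.Icc 0 t) : ‖X.dyson ψ n J s‖ ≤ (X.rate * t) ^ n / n.factorial * ‖ψ‖ := by
  refine (X.norm_dyson_le ψ n J hs.1).trans ?_
  have := X.rate_nonneg
  have := hs.1
  gcongr
  exact hs.2

lemma continuousOn_evolution (X : MarkedFamily ι L H) (ψ : H) (J : Finset L) (T : ℝ) :
    ContinuousOn (X.evolution ψ J) (Set.Icc 0 T) :=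
  continuousOn_tsum (fun n => (X.dyson_continuous ψ n J).continuousOn) (X.summable_rate ψ T)
    fun n _ hs => X.norm_dyson_le_of_le ψ n J hs

omit [CompleteSpace H] in
lemma hasSum_gen (X : MarkedFamily ι L H) (s : ℝ) {F : ℕ → Finset L → H} {G : Finset L → H}
    (h : ∀ J, HasSum (fun n => F n J) (G J)) (J : Finset L) :
    HasSum (fun n => X.gen s (F n) J) (X.gen s G J) := by
  refine hasSum_sum fun i _ => hasSum_sum fun J' _ => ?_
  split_ifs
  · exact (X.op i s).hasSum (h J')
  · exact hasSum_zero

lemma evolution_eq_add_integral (X : MarkedFamily ι L H) (ψ : H) (J : Finset L) {t : ℝ}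
    (ht : 0 ≤ t) : X.evolution ψ J t = (if J = ∅ then ψ else 0) +
      ∫ s in (0 : ℝ)..t, X.gen s (fun J' => X.evolution ψ J' s) J := by
  refine (X.hasSum_dyson ψ J ht).unique ?_
  have key : HasSum (fun n => X.dyson ψ (n + 1) J t)
      (∫ s in (0 : ℝ)..t, X.gen s (fun J' => X.evolution ψ J' s) J) := by
    refine intervalIntegral.hasSum_integral_of_dominated_convergence
      (fun n _ => X.rate * ((X.rate * t) ^ n / n.factorial * ‖ψ‖)) (fun n => ?_) (fun n => ?_)
      (Filter.Eventually.of_forall fun s _ => (X.summable_rate ψ t).mul_left _)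
      intervalIntegrable_const (Filter.Eventually.of_forall fun s hs => ?_)
    · exact (X.gen_stronglyMeasurable
        (fun J' => (X.dyson_continuous ψ n J').stronglyMeasurable) J).aestronglyMeasurable
    · refine Filter.Eventually.of_forall fun s hs => ?_
      rw [Set.uIoc_of_le ht] at hs
      exact X.norm_gen_le_rate s (fun J' => X.norm_dyson_le_of_le ψ n J' ⟨hs.1.le, hs.2⟩) J
    · rw [Set.uIoc_of_le ht] at hs
      exact X.hasSum_gen s (fun J' => X.hasSum_dyson ψ J' hs.1.le) J
  -- Integrating the series raises every order by one; the missing order zero is the initial vector.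
  have := (hasSum_nat_add_iff (f := fun n => X.dyson ψ n J t) 1).1 key
  rw [add_comm]
  simpa [dyson] using this

/-- The newly added set `B = J \ J'` is a nonempty subset of `m` and determines `J'`, while `c ^
|J'| = c ^ |J| c⁻¹ ^ |B|`. Thus the weights depend only on how many labels are new. -/
lemma sum_pow_card_le {c : ℝ} (hc : 0 < c) (J m : Finset L) :
    (∑ J', if J' ∪ m = J ∧ J' ≠ J then c ^ J'.card else 0) ≤
      c ^ J.card * ∑ B ∈ m.powerset.erase ∅, c⁻¹ ^ B.card := by
  rw [← Finset.sum_filter, Finset.mul_sum]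
  have h1 : ∀ J' ∈ Finset.univ.filter fun J' => J' ∪ m = J ∧ J' ≠ J,
      c ^ J'.card = c ^ J.card * c⁻¹ ^ (J \ J').card := by
    intro J' hJ'
    obtain ⟨h, -⟩ := (Finset.mem_filter.1 hJ').2
    have hs : J' ⊆ J := h ▸ Finset.subset_union_left
    rw [← Finset.card_sdiff_add_card_eq_card hs, pow_add, inv_pow]
    field_simp
  rw [Finset.sum_congr rfl h1,
    ← Finset.sum_image (s := Finset.univ.filter fun J' => J' ∪ m = J ∧ J' ≠ J)
      (g := fun J' => J \ J') (f := fun B => c ^ J.card * c⁻¹ ^ B.card)]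
  · refine Finset.sum_le_sum_of_subset_of_nonneg ?_ fun _ _ _ => by positivity
    intro B hB
    obtain ⟨J', hJ', rfl⟩ := Finset.mem_image.1 hB
    obtain ⟨h, hne⟩ := (Finset.mem_filter.1 hJ').2
    rw [Finset.mem_erase, Finset.mem_powerset]
    refine ⟨fun h0 => hne (Finset.Subset.antisymm (h ▸ Finset.subset_union_left)
      (Finset.sdiff_eq_empty_iff_subset.1 h0)), fun x hx => ?_⟩
    rw [← h] at hx
    simp only [Finset.mem_sdiff, Finset.mem_union] at hx
    tauto
  · intro A hA B hB hAB
    have hA' : A ⊆ J := (Finset.mem_filter.1 hA).2.1 ▸ Finset.subset_union_left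
    have hB' : B ⊆ J := (Finset.mem_filter.1 hB).2.1 ▸ Finset.subset_union_left
    simp only at hAB
    rw [← Finset.sdiff_sdiff_eq_self hA', hAB, Finset.sdiff_sdiff_eq_self hB']

omit [CompleteSpace H] in
-- The key cancellation: the terms `J' = J` have zero real part by skewness, so insertions adding no
-- new label cost nothing, however strong they are. The remaining terms are estimated by
-- Cauchy–Schwarz and `sum_pow_card_le`.
lemma re_inner_gen_le (X : MarkedFamily ι L H) (s : ℝ)
    (hskew : ∀ i v, (⟪v, X.op i s v⟫_ℂ).re = 0) {c N γ : ℝ} (hc : 0 < c)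
    (hγ : ∑ i, ‖X.op i s‖ * ∑ B ∈ (X.mark i s).powerset.erase ∅, c⁻¹ ^ B.card ≤ γ)
    {F : Finset L → H} (hF : ∀ J, ‖F J‖ ≤ c ^ J.card * N) (J : Finset L) :
    (⟪F J, X.gen s F J⟫_ℂ).re ≤ (c ^ J.card * N) ^ 2 * γ := by
  have hN : 0 ≤ N := by simpa using (norm_nonneg _).trans (hF ∅)
  calc (⟪F J, X.gen s F J⟫_ℂ).re
      = ∑ i, ∑ J', (⟪F J, if J' ∪ X.mark i s = J then X.op i s (F J') else 0⟫_ℂ).re := by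
        simp only [gen, inner_sum, Complex.re_sum]
    _ ≤ ∑ i, (c ^ J.card * N ^ 2 * ‖X.op i s‖ *
          ∑ J', if J' ∪ X.mark i s = J ∧ J' ≠ J then c ^ J'.card else 0) := by
        refine Finset.sum_le_sum fun i _ => ?_
        rw [Finset.mul_sum]
        refine Finset.sum_le_sum fun J' _ => ?_
        by_cases h1 : J' ∪ X.mark i s = J
        · by_cases h2 : J' = J
          · subst h2
            simp [h1, hskew]
          · simp only [h1, h2, if_true, true_and, ne_eq, not_false_eq_true]
            calc _ ≤ ‖F J‖ * ‖X.op i s (F J')‖ := (Complex.re_le_norm _).trans (norm_inner_le_norm _ _)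
              _ ≤ (c ^ J.card * N) * (‖X.op i s‖ * (c ^ J'.card * N)) := by
                  gcongr
                  · exact hF J
                  · exact (X.op i s).le_opNorm_of_le (hF J')
              _ = _ := by ring
        · simp [h1]
    _ ≤ ∑ i, (c ^ J.card * N ^ 2 * ‖X.op i s‖ *
          (c ^ J.card * ∑ B ∈ (X.mark i s).powerset.erase ∅, c⁻¹ ^ B.card)) := by
        gcongr with i
        exact sum_pow_card_le hc J _
    _ = (c ^ J.card * N) ^ 2 *
          ∑ i, ‖X.op i s‖ * ∑ B ∈ (X.mark i s).powerset.erase ∅, c⁻¹ ^ B.card := by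
        rw [Finset.mul_sum]
        exact Finset.sum_congr rfl fun i _ => by ring
    _ ≤ _ := by gcongr

lemma norm_evolution_le (X : MarkedFamily ι L H)
    (hskew : ∀ i s v, (⟪v, X.op i s v⟫_ℂ).re = 0) {c T : ℝ} (hc : 0 < c) {γ : ℝ → ℝ}
    (hγc : ∀ s, ContinuousWithinAt γ (Set.Ici s) s) (hγm : Measurable γ) (hγ0 : ∀ s, 0 ≤ γ s)
    (hγi : ∀ a b, IntervalIntegrable γ volume a b)
    (hγ : ∀ s ∈ Set.Icc 0 T,
      ∑ i, ‖X.op i s‖ * ∑ B ∈ (X.mark i s).powerset.erase ∅, c⁻¹ ^ B.card ≤ γ s)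
    (ψ : H) (J : Finset L) (hT : 0 ≤ T) :
    ‖X.evolution ψ J T‖ ≤ c ^ J.card * Real.exp (∫ s in (0 : ℝ)..T, γ s) * ‖ψ‖ := by
  set x : Finset L → ℝ → ℝ := fun J t => (‖X.evolution ψ J t‖ / c ^ J.card) ^ 2 with hx
  -- Taking the maximum over all label sets closes the system: growth of one part is controlled by
  -- the others through the same `M`.
  set M : ℝ → ℝ := fun t => Finset.univ.sup' Finset.univ_nonempty fun J => x J t with hM
  have hxM : ∀ J t, x J t ≤ M t := fun J t =>
    Finset.le_sup' (fun J => x J t) (Finset.mem_univ J)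
  have hM0 : ∀ t, 0 ≤ M t := fun t => (sq_nonneg _).trans (hxM ∅ t)
  have hMc : ContinuousOn M (Set.Icc 0 T) := by
    refine ContinuousOn.finset_sup'_apply _ fun J _ => ?_
    exact ((X.continuousOn_evolution ψ J T).norm.div_const _).pow 2
  have hF : ∀ J t, ‖X.evolution ψ J t‖ ≤ c ^ J.card * √(M t) := by
    intro J t
    have := Real.sqrt_le_sqrt (hxM J t)
    rw [hx, Real.sqrt_sq (by positivity), div_le_iff₀ (by positivity)] at this
    linarith
  have hsub : ∀ t ∈ Set.Icc 0 T, Set.Icc 0 t ⊆ Set.Icc 0 T := fun t ht =>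
    Set.Icc_subset_Icc_right ht.2
  have hwi : ∀ t ∈ Set.Icc 0 T, IntervalIntegrable (fun s => 2 * γ s * M s) volume 0 t := by
    intro t ht
    refine ((hγi 0 t).const_mul 2).mul_continuousOn (hMc.mono ?_)
    rw [Set.uIcc_of_le ht.1]
    exact hsub t ht
  have henergy : ∀ J, ∀ t ∈ Set.Icc 0 T, x J t ≤ ‖ψ‖ ^ 2 + ∫ s in (0 : ℝ)..t, 2 * γ s * M s := by
    intro J t ht
    have hbd : ∀ s ∈ Set.Icc 0 t, ‖X.gen s (fun J' => X.evolution ψ J' s) J‖ ≤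
        X.rate * ∑' n : ℕ, (X.rate * t) ^ n / n.factorial * ‖ψ‖ := fun s hs =>
      X.norm_gen_le_rate s (fun J' => tsum_of_norm_bounded (X.summable_rate ψ t).hasSum
        fun n => X.norm_dyson_le_of_le ψ n J' hs) J
    have hvi : IntervalIntegrable (fun s => X.gen s (fun J' => X.evolution ψ J' s) J)
        volume 0 t := by
      -- The evolution is known to be continuous only on `[0, t]`, whereas `gen_intervalIntegrable`
      -- needs global continuity; the constant extension agrees with it on the interval of
      -- integration.
      have hc : ∀ J', Continuous (Set.IccExtend ht.1 ((Set.Icc 0 t).domRestrict (X.evolution ψ J'))) :=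
        fun J' => (X.continuousOn_evolution ψ J' t).domRestrict.Icc_extend'
      refine (X.gen_intervalIntegrable hc J 0 t).congr fun s hs => ?_
      rw [Set.uIoc_of_le ht.1] at hs
      simp only [Set.IccExtend_of_mem _ _ (Set.Ioc_subset_Icc_self hs)]
      rfl
    have h := norm_sq_le_add_integral (w := fun s => (c ^ J.card) ^ 2 * (2 * γ s * M s)) ht.1 hvi hbd
      (u := X.evolution ψ J) (u₀ := if J = ∅ then ψ else 0)
      (fun s hs => X.evolution_eq_add_integral ψ J hs.1) ((hwi t ht).const_mul _) ?_
    · rw [intervalIntegral.integral_const_mul] at h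
      simp only [hx, div_pow]
      rw [div_le_iff₀ (by positivity)]
      refine h.trans ?_
      rw [add_mul, mul_comm ((c ^ J.card) ^ 2)]
      gcongr
      split_ifs with hJ
      · simp [hJ]
      · simp; positivity
    · intro s hs
      have := X.re_inner_gen_le s (hskew · s) hc (hγ s (hsub t ht hs)) (fun J' => hF J' s) J
      rw [mul_pow, Real.sq_sqrt (hM0 s)] at this
      linarith
  have hgron := le_mul_exp_integral (γ := fun s => 2 * γ s) hMc
    (fun s => continuousWithinAt_const.mul (hγc s)) (fun s => by have := hγ0 s; positivity)
    (hγm.const_mul 2) (fun a b => (hγi a b).const_mul 2)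
    (fun t ht => Finset.sup'_le _ _ fun J _ => henergy J t ht) T ⟨hT, le_rfl⟩
  have h := (hxM J T).trans hgron
  -- The rate `2γ` for squared norms makes the exponential a perfect square, so taking roots leaves
  -- `exp(∫ γ)`.
  rw [intervalIntegral.integral_const_mul, two_mul, Real.exp_add, ← sq, ← mul_pow] at h
  have := (pow_le_pow_iff_left₀ (by positivity) (by positivity) two_ne_zero).1 h
  rw [div_le_iff₀ (by positivity)] at this
  linarith

end MarkedFamily

/-! ### Counting the locations struck by a coupling term. -/

/-- Each `S` arises from at least `j!` tuples, one for every enumeration of `S.erase q`. This is the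
source of the factorials in the denominators of `g_k`. -/
lemma factorial_mul_sum_le_sum_tuples {Q : Type*} [Fintype Q] [DecidableEq Q] {h : Finset Q → ℝ}
    (h0 : ∀ S, 0 ≤ h S) (q : Q) (j : ℕ) :
    (j.factorial : ℝ) * ∑ S with q ∈ S ∧ S.card = j + 1, h S ≤
      ∑ i : Fin j → Q, if Function.Injective (Fin.cons q i : Fin (j + 1) → Q)
        then h (Finset.univ.image (Fin.cons q i : Fin (j + 1) → Q)) else 0 := by
  classical
  set P : Finset Q → (Fin j → Q) → Prop := fun S i =>
    Function.Injective (Fin.cons q i : Fin (j + 1) → Q) ∧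
      Finset.univ.image (Fin.cons q i : Fin (j + 1) → Q) = S with hP
  have hcard : ∀ S : Finset Q, q ∈ S ∧ S.card = j + 1 →
      j.factorial ≤ (Finset.univ.filter fun i => P S i).card := by
    rintro S ⟨hq, hS⟩
    have hc : Fintype.card (Fin j) = Fintype.card (S.erase q) := by
      rw [Fintype.card_fin, Fintype.card_coe, Finset.card_erase_of_mem hq, hS, Nat.add_sub_cancel]
    have h1 : Fintype.card (Fin j ≃ S.erase q) = j.factorial := by
      rw [Fintype.card_equiv (Fintype.equivOfCardEq hc), Fintype.card_fin]
    rw [← h1, ← Finset.card_univ]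
    refine Finset.card_le_card_of_injOn (fun e a => (e a : Q)) (fun e _ => ?_) ?_
    · have hinj : Function.Injective (Fin.cons q (fun a => (e a : Q)) : Fin (j + 1) → Q) := by
        rw [Fin.cons_injective_iff]
        refine ⟨?_, Subtype.val_injective.comp e.injective⟩
        rintro ⟨a, ha⟩
        exact (Finset.mem_erase.1 (e a).2).1 ha
      simp only [Finset.coe_filter, Finset.mem_univ, true_and]
      refine ⟨hinj, Finset.eq_of_subset_of_card_le ?_ ?_⟩
      · intro y hy
        obtain ⟨a, -, rfl⟩ := Finset.mem_image.1 hy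
        induction a using Fin.cases with
        | zero => simpa using hq
        | succ a => simpa using (Finset.mem_erase.1 (e a).2).2
      · rw [Finset.card_image_of_injective _ hinj, hS]
        simp
    · intro e _ e' _ hee
      ext a
      exact congrFun hee a
  calc (j.factorial : ℝ) * ∑ S with q ∈ S ∧ S.card = j + 1, h S
      ≤ ∑ S with q ∈ S ∧ S.card = j + 1, ∑ i : Fin j → Q, if P S i then h S else 0 := by
        rw [Finset.mul_sum]
        refine Finset.sum_le_sum fun S hS => ?_
        rw [← Finset.sum_filter, Finset.sum_const, nsmul_eq_mul]
        exact mul_le_mul_of_nonneg_right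
          (by exact_mod_cast hcard S (Finset.mem_filter.1 hS).2) (h0 S)
    _ ≤ ∑ S, ∑ i : Fin j → Q, if P S i then h S else 0 := by
        refine Finset.sum_le_sum_of_subset_of_nonneg (Finset.filter_subset _ _) fun S _ _ =>
          Finset.sum_nonneg fun i _ => ?_
        split_ifs
        exacts [h0 S, le_rfl]
    _ = _ := by
        rw [Finset.sum_comm]
        refine Finset.sum_congr rfl fun i _ => ?_
        simp only [hP, ite_and]
        split_ifs <;> simp

/-- With `n = |B|`, use `(k+1) C(n, k+1) = n C(n-1, k) ≤ n 2^N`. Keeping the factor `n` outside lets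
it be distributed over the struck qubits afterwards. -/
lemma sum_powerset_erase_le {L : Type*} [DecidableEq L] (B : Finset L) {N : ℕ} (hN : B.card ≤ N + 1)
    {x : ℝ} (hx : 0 ≤ x) :
    ∑ A ∈ B.powerset.erase ∅, x ^ A.card ≤
      B.card * (2 ^ N * ∑ k ∈ Finset.range (N + 1), x ^ (k + 1) / (k + 1)) := by
  have h1 : ∑ A ∈ B.powerset.erase ∅, x ^ A.card =
      ∑ k ∈ Finset.range B.card, (B.card.choose (k + 1) : ℝ) * x ^ (k + 1) := by
    have h2 := Finset.sum_powerset_apply_card (fun k => x ^ k) (x := B)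
    rw [Finset.sum_range_succ', ← Finset.add_sum_erase _ _ (Finset.empty_mem_powerset B)] at h2
    simp only [Finset.card_empty, pow_zero, Nat.choose_zero_right, one_smul, nsmul_eq_mul] at h2
    linarith
  rw [h1, Finset.mul_sum, Finset.mul_sum]
  refine (Finset.sum_le_sum_of_subset_of_nonneg (Finset.range_subset_range.2 hN)
    fun _ _ _ => by positivity).trans (Finset.sum_le_sum fun k _ => ?_)
  rcases Nat.eq_zero_or_pos B.card with h0 | h0
  · simp [h0]
  obtain ⟨n, hn⟩ := Nat.exists_eq_succ_of_ne_zero h0.ne'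
  have h3 : (n + 1) * n.choose k = (n + 1).choose (k + 1) * (k + 1) := Nat.add_one_mul_choose_eq n k
  have h4 : n.choose k ≤ 2 ^ N := (Nat.choose_le_two_pow n k).trans
    (Nat.pow_le_pow_right two_pos (by omega))
  have h5 : (B.card.choose (k + 1) : ℝ) * (k + 1) ≤ B.card * 2 ^ N := by
    rw [hn]
    exact_mod_cast h3 ▸ Nat.mul_le_mul_left (n + 1) h4
  calc (B.card.choose (k + 1) : ℝ) * x ^ (k + 1)
      = (B.card.choose (k + 1) : ℝ) * (k + 1) * (x ^ (k + 1) / (k + 1)) := by field_simp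
    _ ≤ B.card * 2 ^ N * (x ^ (k + 1) / (k + 1)) := by gcongr
    _ = _ := by ring

lemma gTerm_nonneg {f : ℕ → ℝ} {α : ℝ} (hα : 0 ≤ α) (hf : ∀ k, 1 ≤ k → 0 ≤ f k) {k : ℕ}
    (hk : 1 ≤ k) (l : ℕ) : 0 ≤ gTerm f α k l := by
  have := hf (k + l) (by omega)
  unfold gTerm
  positivity

/-- Substituting `j = k + l` turns the double sum into truncations of `g_{k+1}` with coefficients
`(2αx)^(k+1) / (2 (k+1)!)`. The prefactor `m` is absorbed through `m ≤ m^(k+1)` and `2mαx ≤ 1`. -/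
lemma mul_sum_sum_le_tsum {f : ℕ → ℝ} {α x : ℝ} (hα : 0 ≤ α) (hx : 0 ≤ x) {m : ℕ}
    (hmx : 2 * m * α * x ≤ 1) (hf : ∀ k, 1 ≤ k → 0 ≤ f k)
    (hg : ∀ k, 1 ≤ k → Summable (gTerm f α k))
    (hsum : Summable fun k : ℕ => g f α (k + 1) / (2 * ((k + 1).factorial : ℝ))) (N : ℕ) :
    m * ∑ j ∈ Finset.range N, f (j + 1) * α ^ (j + 1) / j.factorial *
        (2 ^ j * ∑ k ∈ Finset.range (j + 1), x ^ (k + 1) / (k + 1)) ≤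
      ∑' k : ℕ, g f α (k + 1) / (2 * ((k + 1).factorial : ℝ)) := by
  have hg0 : ∀ k, 0 ≤ g f α (k + 1) := fun k => tsum_nonneg (gTerm_nonneg hα hf (by omega))
  have hflip := Finset.sum_range_diag_flip N fun k l : ℕ =>
    f (k + l + 1) * α ^ (k + l + 1) / (k + l).factorial * 2 ^ (k + l) * (x ^ (k + 1) / (k + 1))
  have h1 : ∑ j ∈ Finset.range N, f (j + 1) * α ^ (j + 1) / j.factorial *
        (2 ^ j * ∑ k ∈ Finset.range (j + 1), x ^ (k + 1) / (k + 1)) =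
      ∑ k ∈ Finset.range N, ∑ l ∈ Finset.range (N - k),
        f (k + l + 1) * α ^ (k + l + 1) / (k + l).factorial * 2 ^ (k + l) *
          (x ^ (k + 1) / (k + 1)) := by
    rw [← hflip]
    refine Finset.sum_congr rfl fun j _ => ?_
    rw [← mul_assoc, Finset.mul_sum]
    refine Finset.sum_congr rfl fun k hk => ?_
    rw [Nat.add_sub_cancel' (by simpa [Nat.lt_succ_iff] using hk)]
  rw [h1, Finset.mul_sum]
  refine (Finset.sum_le_sum fun k _ => ?_).trans
    (hsum.sum_le_tsum (Finset.range N) fun k _ => by have := hg0 k; positivity)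
  have h2 : ∀ l, f (k + l + 1) * α ^ (k + l + 1) / (k + l).factorial * 2 ^ (k + l) *
      (x ^ (k + 1) / (k + 1)) =
      (2 * α * x) ^ (k + 1) / (2 * ((k + 1).factorial : ℝ)) * gTerm f α (k + 1) l := by
    intro l
    have e1 : k + 1 + l = k + l + 1 := by ring
    simp only [gTerm, e1, Nat.add_sub_cancel, Nat.factorial_succ k]
    push_cast
    field_simp
    ring
  have h3 : (m : ℝ) * (2 * α * x) ^ (k + 1) ≤ 1 := by
    calc (m : ℝ) * (2 * α * x) ^ (k + 1) ≤ (m : ℝ) ^ (k + 1) * (2 * α * x) ^ (k + 1) := by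
          gcongr
          exact_mod_cast Nat.le_self_pow (by omega) m
      _ = (2 * m * α * x) ^ (k + 1) := by rw [← mul_pow]; ring
      _ ≤ 1 := pow_le_one₀ (by positivity) hmx
  simp only [h2]
  rw [← Finset.mul_sum]
  have h4 : ∑ l ∈ Finset.range (N - k), gTerm f α (k + 1) l ≤ g f α (k + 1) :=
    (hg (k + 1) (by omega)).sum_le_tsum _ fun l _ => gTerm_nonneg hα hf (by omega) l
  have h5 : 0 ≤ ∑ l ∈ Finset.range (N - k), gTerm f α (k + 1) l :=
    Finset.sum_nonneg fun l _ => gTerm_nonneg hα hf (by omega) l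
  calc (m : ℝ) * ((2 * α * x) ^ (k + 1) / (2 * ((k + 1).factorial : ℝ)) *
        ∑ l ∈ Finset.range (N - k), gTerm f α (k + 1) l)
      = (m : ℝ) * (2 * α * x) ^ (k + 1) * ((∑ l ∈ Finset.range (N - k), gTerm f α (k + 1) l) /
        (2 * ((k + 1).factorial : ℝ))) := by ring
    _ ≤ 1 * (g f α (k + 1) / (2 * ((k + 1).factorial : ℝ))) := by gcongr
    _ = _ := one_mul _

/-- The total weight of the nonempty sets of simultaneously executed locations that are struck by a
single coupling term. -/
lemma sum_mul_sum_powerset_le {Q L : Type*} [Fintype Q] [DecidableEq Q] [DecidableEq L]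
    {h : Finset Q → ℝ} (h0 : ∀ S, 0 ≤ h S) (active : Finset L) (qubits : L → Finset Q)
    (hdisj : ∀ ℓ ∈ active, ∀ ℓ' ∈ active, ℓ ≠ ℓ' → Disjoint (qubits ℓ) (qubits ℓ'))
    {m : ℕ} (hm : ∀ ℓ, (qubits ℓ).card ≤ m) {f : ℕ → ℝ} {α x t₀ : ℝ} (ht₀ : 0 < t₀)
    (hα : 0 ≤ α) (hx : 0 ≤ x) (hmx : 2 * m * α * x ≤ 1) (hf : ∀ k, 1 ≤ k → 0 ≤ f k)
    (hg : ∀ k, 1 ≤ k → Summable (gTerm f α k))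
    (hsum : Summable fun k : ℕ => g f α (k + 1) / (2 * ((k + 1).factorial : ℝ)))
    (hh : ∀ q j, (j.factorial : ℝ) * (∑ S with q ∈ S ∧ S.card = j + 1, h S) * t₀ ≤
      f (j + 1) * α ^ (j + 1)) :
    ∑ S : Finset Q, h S *
        ∑ B ∈ (active.filter fun ℓ => ∃ q ∈ qubits ℓ, q ∈ S).powerset.erase ∅, x ^ B.card ≤
      active.card * ((∑' k : ℕ, g f α (k + 1) / (2 * ((k + 1).factorial : ℝ))) / t₀) := by
  set w : ℕ → ℝ := fun N => 2 ^ N * ∑ k ∈ Finset.range (N + 1), x ^ (k + 1) / (k + 1) with hw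
  have hw0 : ∀ N, 0 ≤ w N := fun N => by simp only [hw]; positivity
  -- Simultaneous locations use disjoint qubits, so each struck one claims its own element of `S`.
  -- This supplies the exponent `|S| - 1` in `w`.
  have hcard : ∀ S : Finset Q, (active.filter fun ℓ => ∃ q ∈ qubits ℓ, q ∈ S).card ≤ S.card := by
    intro S
    calc _ ≤ ∑ ℓ ∈ active.filter fun ℓ => ∃ q ∈ qubits ℓ, q ∈ S, (qubits ℓ ∩ S).card := by
          rw [Finset.card_eq_sum_ones]
          refine Finset.sum_le_sum fun ℓ hℓ => Finset.card_pos.2 ?_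
          obtain ⟨q, hq, hqS⟩ := (Finset.mem_filter.1 hℓ).2
          exact ⟨q, Finset.mem_inter.2 ⟨hq, hqS⟩⟩
      _ = ((active.filter fun ℓ => ∃ q ∈ qubits ℓ, q ∈ S).biUnion fun ℓ => qubits ℓ ∩ S).card := by
          refine (Finset.card_biUnion fun ℓ hℓ ℓ' hℓ' hne => ?_).symm
          exact (hdisj ℓ (Finset.mem_filter.1 hℓ).1 ℓ' (Finset.mem_filter.1 hℓ').1 hne).mono
            Finset.inter_subset_left Finset.inter_subset_left
      _ ≤ S.card := Finset.card_le_card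
          (Finset.biUnion_subset.2 fun ℓ _ => Finset.inter_subset_right)
  -- A second bound on the same count, by struck qubits: it allows the sum over `S` to be
  -- reorganized as sums over `S ∋ q` for fixed `q`, which the noise strength controls.
  have hcard' : ∀ S : Finset Q, ((active.filter fun ℓ => ∃ q ∈ qubits ℓ, q ∈ S).card : ℝ) ≤
      ∑ ℓ ∈ active, ∑ q ∈ qubits ℓ, if q ∈ S then 1 else 0 := by
    intro S
    rw [Finset.card_eq_sum_ones, Finset.sum_filter]
    push_cast
    refine Finset.sum_le_sum fun ℓ _ => ?_
    have hnn : ∀ q ∈ qubits ℓ, (0 : ℝ) ≤ if q ∈ S then 1 else 0 := fun q _ => by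
      split_ifs <;> norm_num
    split_ifs with hex
    · obtain ⟨q, hq, hqS⟩ := hex
      simpa [hqS] using Finset.single_le_sum hnn hq
    · exact Finset.sum_nonneg hnn
  calc _ ≤ ∑ S : Finset Q, h S * ((∑ ℓ ∈ active, ∑ q ∈ qubits ℓ, if q ∈ S then 1 else 0) *
          w (S.card - 1)) := by
        refine Finset.sum_le_sum fun S _ => mul_le_mul_of_nonneg_left ?_ (h0 S)
        refine (sum_powerset_erase_le (N := S.card - 1) _ ?_ hx).trans
          (mul_le_mul_of_nonneg_right (hcard' S) (hw0 _))
        have := hcard S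
        omega
    _ = ∑ ℓ ∈ active, ∑ q ∈ qubits ℓ, ∑ S with q ∈ S, h S * w (S.card - 1) := by
        simp only [Finset.sum_mul, Finset.mul_sum]
        rw [Finset.sum_comm]
        refine Finset.sum_congr rfl fun ℓ _ => ?_
        rw [Finset.sum_comm]
        refine Finset.sum_congr rfl fun q _ => ?_
        rw [Finset.sum_filter]
        refine Finset.sum_congr rfl fun S _ => ?_
        split_ifs <;> simp
    _ ≤ ∑ ℓ ∈ active, ∑ q ∈ qubits ℓ, (∑ j ∈ Finset.range (Fintype.card Q),
          f (j + 1) * α ^ (j + 1) / j.factorial * w j) / t₀ := by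
        refine Finset.sum_le_sum fun ℓ _ => Finset.sum_le_sum fun q _ => ?_
        have hmaps : ∀ S ∈ Finset.univ.filter fun S : Finset Q => q ∈ S,
            S.card - 1 ∈ Finset.range (Fintype.card Q) := by
          intro S hS
          have h1 : 0 < S.card := Finset.card_pos.2 ⟨q, (Finset.mem_filter.1 hS).2⟩
          have h2 := Finset.card_le_univ S
          rw [Finset.mem_range]
          omega
        rw [← Finset.sum_fiberwise_of_maps_to hmaps, Finset.sum_div]
        refine Finset.sum_le_sum fun j _ => ?_
        have h1 : (Finset.univ.filter fun S : Finset Q => q ∈ S).filter (fun S => S.card - 1 = j) =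
            Finset.univ.filter fun S : Finset Q => q ∈ S ∧ S.card = j + 1 := by
          ext S
          simp only [Finset.mem_filter, Finset.mem_univ, true_and]
          refine and_congr_right fun hq => ?_
          have h1 : 0 < S.card := Finset.card_pos.2 ⟨q, hq⟩
          omega
        rw [h1]
        have h2 : ∑ S with q ∈ S ∧ S.card = j + 1, h S * w (S.card - 1) =
            (∑ S with q ∈ S ∧ S.card = j + 1, h S) * w j := by
          rw [Finset.sum_mul]
          refine Finset.sum_congr rfl fun S hS => ?_
          rw [(Finset.mem_filter.1 hS).2.2, Nat.add_sub_cancel]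
        rw [h2, mul_div_right_comm]
        refine mul_le_mul_of_nonneg_right ?_ (hw0 j)
        rw [div_div, le_div_iff₀ (by positivity)]
        linarith [hh q j]
    _ = ∑ ℓ ∈ active, (qubits ℓ).card * ((∑ j ∈ Finset.range (Fintype.card Q),
          f (j + 1) * α ^ (j + 1) / j.factorial * w j) / t₀) := by
        simp only [Finset.sum_const, nsmul_eq_mul]
    _ ≤ ∑ ℓ ∈ active, m * ((∑ j ∈ Finset.range (Fintype.card Q),
          f (j + 1) * α ^ (j + 1) / j.factorial * w j) / t₀) := by
        refine Finset.sum_le_sum fun ℓ _ => mul_le_mul_of_nonneg_right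
          (by exact_mod_cast hm ℓ) (div_nonneg (Finset.sum_nonneg fun j _ => ?_) ht₀.le)
        have := hf (j + 1) (by omega)
        have := hw0 j
        positivity
    _ ≤ _ := by
        rw [Finset.sum_const, nsmul_eq_mul]
        gcongr
        rw [← mul_div_assoc]
        gcongr
        exact mul_sum_sum_le_tsum hα hx hmx hf hg hsum _

/-! ### Linearity of the evolution in the initial vector. -/

namespace MarkedFamily

variable {ι L H : Type*} [Fintype ι] [Fintype L] [DecidableEq L]
  [NormedAddCommGroup H] [InnerProductSpace ℂ H] [CompleteSpace H]

omit [Fintype ι] [Fintype L] [CompleteSpace H] in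
lemma term_add (X : MarkedFamily ι L H) (ψ φ : H) {n : ℕ} (S : Fin n → ι) (J : Finset L) (t : ℝ) :
    X.term (ψ + φ) S J t = X.term ψ S J t + X.term φ S J t := by
  simp only [term, map_add]
  exact integral_add (X.integrableOn_product S J t ψ) (X.integrableOn_product S J t φ)

omit [Fintype ι] [Fintype L] [CompleteSpace H] in
lemma term_smul (X : MarkedFamily ι L H) (a : ℂ) (ψ : H) {n : ℕ} (S : Fin n → ι) (J : Finset L)
    (t : ℝ) : X.term (a • ψ) S J t = a • X.term ψ S J t := by
  simp only [term, map_smul]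
  exact integral_smul _ _

/-- `evolution` as a linear map in the initial vector. -/
def evolutionLinear (X : MarkedFamily ι L H) (J : Finset L) {t : ℝ} (ht : 0 ≤ t) : H →ₗ[ℂ] H where
  toFun ψ := X.evolution ψ J t
  map_add' ψ φ := by
    refine (X.hasSum_dyson (ψ + φ) J ht).unique ?_
    convert (X.hasSum_dyson ψ J ht).add (X.hasSum_dyson φ J ht) using 2 with n
    simp only [X.dyson_eq_sum_term _ n J ht, term_add, Finset.sum_add_distrib]
  map_smul' a ψ := by
    refine (X.hasSum_dyson (a • ψ) J ht).unique ?_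
    rw [RingHom.id_apply]
    convert (X.hasSum_dyson ψ J ht).const_smul a using 2 with n
    simp only [X.dyson_eq_sum_term _ n J ht, term_smul, Finset.smul_sum]

end MarkedFamily

/-! ### Unitarity and strong continuity of the free evolution. -/

section FreeEvolution

variable {Q 𝓑 : Type*} [Fintype Q] [DecidableEq Q]
  [NormedAddCommGroup 𝓑] [InnerProductSpace ℂ 𝓑] [CompleteSpace 𝓑]

lemma adjoint_ofBlocks (A : Bits Q → Bits Q → (𝓑 →L[ℂ] 𝓑)) :
    ContinuousLinearMap.adjoint (ofBlocks A) =
      ofBlocks fun x y => ContinuousLinearMap.adjoint (A y x) := by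
  symm
  rw [ContinuousLinearMap.eq_adjoint_iff]
  intro φ ψ
  simp only [PiLp.inner_apply, ofBlocks_apply, sum_inner, inner_sum,
    ContinuousLinearMap.adjoint_inner_left]
  exact Finset.sum_comm

variable {U : ℝ → Matrix (Bits Q) (Bits Q) ℂ} {V : ℝ → 𝓑 →L[ℂ] 𝓑}

omit [CompleteSpace 𝓑] in
lemma freeEvolution_apply (t : ℝ) (ψ : Joint Q 𝓑) (x : Bits Q) :
    freeEvolution U V t ψ x = ∑ y, U t x y • V t (ψ y) := by
  simp [freeEvolution, ofBlocks_apply]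

lemma adjoint_freeEvolution_apply (t : ℝ) (ψ : Joint Q 𝓑) (x : Bits Q) :
    ContinuousLinearMap.adjoint (freeEvolution U V t) ψ x =
      ∑ y, star (U t y x) • ContinuousLinearMap.adjoint (V t) (ψ y) := by
  simp [freeEvolution, adjoint_ofBlocks, ofBlocks_apply, map_smulₛₗ]

lemma freeEvolution_mem_unitary {t : ℝ} (hU : U t ∈ Matrix.unitaryGroup (Bits Q) ℂ)
    (hV : V t ∈ unitary (𝓑 →L[ℂ] 𝓑)) :
    freeEvolution U V t ∈ unitary (Joint Q 𝓑 →L[ℂ] Joint Q 𝓑) := by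
  have hV1 : ∀ v, ContinuousLinearMap.adjoint (V t) (V t v) = v := fun v =>
    DFunLike.congr_fun (Unitary.star_mul_self_of_mem hV) v
  have hV2 : ∀ v, V t (ContinuousLinearMap.adjoint (V t) v) = v := fun v =>
    DFunLike.congr_fun (Unitary.mul_star_self_of_mem hV) v
  have hU1 : ∀ x z, ∑ y, star (U t y x) * U t y z = (1 : Matrix (Bits Q) (Bits Q) ℂ) x z :=
    fun x z => congrFun (congrFun (Matrix.mem_unitaryGroup_iff'.1 hU) x) z
  have hU2 : ∀ x z, ∑ y, U t x y * star (U t z y) = (1 : Matrix (Bits Q) (Bits Q) ℂ) x z :=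
    fun x z => congrFun (congrFun (Matrix.mem_unitaryGroup_iff.1 hU) x) z
  rw [Unitary.mem_iff]
  constructor
  · ext ψ x
    change ContinuousLinearMap.adjoint (freeEvolution U V t) (freeEvolution U V t ψ) x = ψ x
    simp only [adjoint_freeEvolution_apply, freeEvolution_apply, map_sum, map_smul, hV1,
      Finset.smul_sum, smul_smul]
    rw [Finset.sum_comm]
    simp only [← Finset.sum_smul, hU1, Matrix.one_apply, ite_smul, one_smul, zero_smul,
      Finset.sum_ite_eq, Finset.mem_univ, if_true]
  · ext ψ x
    change freeEvolution U V t (ContinuousLinearMap.adjoint (freeEvolution U V t) ψ) x = ψ x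
    simp only [adjoint_freeEvolution_apply, freeEvolution_apply, map_sum, map_smul, hV2,
      Finset.smul_sum, smul_smul]
    rw [Finset.sum_comm]
    simp only [← Finset.sum_smul, hU2, Matrix.one_apply, ite_smul, one_smul, zero_smul,
      Finset.sum_ite_eq, Finset.mem_univ, if_true]

omit [CompleteSpace 𝓑] in
lemma continuous_freeEvolution (hU : Continuous U) (hV : ∀ ψ, Continuous fun t => V t ψ)
    (ψ : Joint Q 𝓑) : Continuous fun t => freeEvolution U V t ψ := by
  refine (PiLp.continuous_toLp 2 (fun _ : Bits Q => 𝓑)).comp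
    (g := WithLp.toLp 2) (f := fun t x => freeEvolution U V t ψ x) ?_
  refine continuous_pi fun x => ?_
  simp only [freeEvolution_apply]
  exact continuous_finsetSum _ fun y _ => (hU.matrix_elem x y).smul (hV _)

end FreeEvolution

section Unitary

variable {H : Type*} [NormedAddCommGroup H] [InnerProductSpace ℂ H] [CompleteSpace H]

lemma norm_le_one_of_mem_unitary {W : H →L[ℂ] H} (hW : W ∈ unitary (H →L[ℂ] H)) : ‖W‖ ≤ 1 := by
  refine W.opNorm_le_bound zero_le_one fun v => ?_
  rw [one_mul]
  exact (ContinuousLinearMap.norm_map_of_mem_unitary hW v).le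

/-- Taking adjoints is not strongly continuous in general. For unitaries, with `v = W(s)* ψ`, one
has `‖W(t)* ψ - v‖ = ‖ψ - W(t) v‖`, which tends to `0` as `t → s`. -/
lemma continuous_adjoint_of_mem_unitary {W : ℝ → H →L[ℂ] H} (hW : ∀ t, W t ∈ unitary (H →L[ℂ] H))
    (hc : ∀ ψ, Continuous fun t => W t ψ) (ψ : H) :
    Continuous fun t => ContinuousLinearMap.adjoint (W t) ψ := by
  rw [continuous_iff_continuousAt]
  intro s
  have hr : ∀ t v, W t (ContinuousLinearMap.adjoint (W t) v) = v := fun t v =>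
    DFunLike.congr_fun (Unitary.mul_star_self_of_mem (hW t)) v
  set v := ContinuousLinearMap.adjoint (W s) ψ with hv
  have hlim : Filter.Tendsto (fun t => ‖W t v - ψ‖) (nhds s) (nhds 0) := by
    have h0 : ‖W s v - ψ‖ = 0 := by rw [hv, hr, sub_self, norm_zero]
    rw [← h0]
    exact ((hc v).sub continuous_const).norm.tendsto s
  rw [ContinuousAt, tendsto_iff_norm_sub_tendsto_zero]
  refine hlim.congr fun t => ?_
  rw [← ContinuousLinearMap.norm_map_of_mem_unitary (hW t)
    (ContinuousLinearMap.adjoint (W t) ψ - v), map_sub, hr, norm_sub_rev]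

lemma re_inner_neg_I_smul_conj (W : H →L[ℂ] H) {A : H →L[ℂ] H} (hA : IsSelfAdjoint A) (v : H) :
    (⟪v, ((-Complex.I) • (ContinuousLinearMap.adjoint W ∘L A ∘L W)) v⟫_ℂ).re = 0 := by
  have h1 : ⟪v, ((-Complex.I) • (ContinuousLinearMap.adjoint W ∘L A ∘L W)) v⟫_ℂ =
      -Complex.I * ⟪W v, A (W v)⟫_ℂ := by
    rw [smul_apply, inner_smul_right]
    simp [ContinuousLinearMap.adjoint_inner_right]
  have h2 : (⟪W v, A (W v)⟫_ℂ).im = 0 := by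
    rw [← Complex.conj_eq_iff_im, inner_conj_symm]
    exact hA.isSymmetric (W v) (W v)
  rw [h1]
  simp [h2]

end Unitary

/-- The indicator function of a half-open interval is right-continuous. -/
lemma continuousWithinAt_indicator_Ico (a b C s : ℝ) :
    ContinuousWithinAt ((Set.Ico a b).indicator fun _ => C) (Set.Ici s) s := by
  rcases lt_or_ge s a with h | h
  · refine ContinuousAt.continuousWithinAt ?_
    refine (continuousAt_const (y := (0 : ℝ))).congr ?_
    filter_upwards [Iio_mem_nhds h] with t ht
    rw [Set.indicator_of_notMem fun hc => absurd hc.1 (not_le.2 ht)]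
  · rcases lt_or_ge s b with h' | h'
    · refine (continuousWithinAt_const (b := C)).congr_of_eventuallyEq_of_mem ?_ Set.self_mem_Ici
      filter_upwards [Ico_mem_nhdsGE h'] with t ht
      rw [Set.indicator_of_mem (Set.mem_Ico.2 ⟨h.trans ht.1, ht.2⟩)]
    · refine (continuousWithinAt_const (b := (0 : ℝ))).congr (fun t ht => ?_) ?_
      · exact Set.indicator_of_notMem (fun hc => absurd hc.2 (not_lt.2 (h'.trans ht))) _
      · exact Set.indicator_of_notMem (fun hc => absurd hc.2 (not_lt.2 h')) _

lemma intervalIntegrable_indicator_Ico (a b C u v : ℝ) :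
    IntervalIntegrable ((Set.Ico a b).indicator fun _ => C) volume u v := by
  rw [intervalIntegrable_iff]
  exact ((integrable_indicator_iff measurableSet_Ico).2
    (integrableOn_const (measure_Ico_lt_top.ne))).integrableOn

lemma integral_indicator_Ico_le {a b C T : ℝ} (hab : a ≤ b) (hC : 0 ≤ C) (hT : 0 ≤ T) :
    ∫ s in (0 : ℝ)..T, (Set.Ico a b).indicator (fun _ => C) s ≤ (b - a) * C := by
  rw [intervalIntegral.integral_of_le hT]
  refine (setIntegral_le_integral ((integrable_indicator_iff measurableSet_Ico).2
    (integrableOn_const (measure_Ico_lt_top.ne))) (Filter.Eventually.of_forall fun s =>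
      Set.indicator_nonneg (fun _ _ => hC) s)).trans (le_of_eq ?_)
  rw [integral_indicator measurableSet_Ico, setIntegral_const, Real.volume_real_Ico_of_le hab,
    smul_eq_mul]

/-! ### The coupling in the interaction picture as a marked family. -/

section Noise

variable {Q Loc 𝓑 : Type*} [Fintype Q] [DecidableEq Q]
  [NormedAddCommGroup 𝓑] [InnerProductSpace ℂ 𝓑] [CompleteSpace 𝓑]

lemma Circuit.maxDuration_pos [Finite Loc] [Nonempty Loc] (C : Circuit Q Loc) :
    0 < C.maxDuration := by
  obtain ⟨ℓ⟩ := ‹Nonempty Loc›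
  exact (sub_pos.2 (C.startTime_lt_endTime ℓ)).trans_le
    (le_ciSup (f := fun ℓ => C.endTime ℓ - C.startTime ℓ) (Set.finite_range _).bddAbove ℓ)

lemma Circuit.duration_le [Finite Loc] (C : Circuit Q Loc) (ℓ : Loc) :
    C.endTime ℓ - C.startTime ℓ ≤ C.maxDuration :=
  le_ciSup (f := fun ℓ => C.endTime ℓ - C.startTime ℓ) (Set.finite_range _).bddAbove ℓ

lemma Circuit.T_nonneg [Nonempty Loc] (C : Circuit Q Loc) : 0 ≤ C.T := by
  obtain ⟨ℓ⟩ := ‹Nonempty Loc›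
  exact ((C.startTime_nonneg ℓ).trans (C.startTime_lt_endTime ℓ).le).trans (C.endTime_le ℓ)

lemma NoisyComputation.factorial_mul_sum_norm_coupling_le (M : NoisyComputation Q Loc 𝓑) {j : ℕ}
    {r : ℝ} (hr : 0 ≤ r) (ht₀ : 0 ≤ M.maxDuration) (h : M.strength (j + 1) ≤ ENNReal.ofReal r)
    (q : Q) {t : ℝ} (ht : t ∈ Set.Icc 0 M.T) :
    (j.factorial : ℝ) * (∑ S with q ∈ S ∧ S.card = j + 1, ‖M.coupling S t‖) * M.maxDuration ≤
      r := by
  have h1 := (le_iSup₂ (f := fun (i₁ : Q) (t : Set.Icc (0 : ℝ) M.T) => ∑ i : Fin j → Q,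
    ‖M.tupleCoupling (j + 1) (Fin.cons i₁ i) t‖ₑ * ENNReal.ofReal M.maxDuration) q ⟨t, ht⟩).trans h
  simp only [← ofReal_norm, ← ENNReal.ofReal_mul (norm_nonneg _)] at h1
  rw [← ENNReal.ofReal_sum_of_nonneg (fun _ _ => by positivity),
    ENNReal.ofReal_le_ofReal_iff hr, ← Finset.sum_mul] at h1
  refine (mul_le_mul_of_nonneg_right ?_ ht₀).trans h1
  refine (factorial_mul_sum_le_sum_tuples (h := fun S => ‖M.coupling S t‖)
    (fun _ => norm_nonneg _) q j).trans (le_of_eq (Finset.sum_congr rfl fun i _ => ?_))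
  rw [NoisyComputation.tupleCoupling]
  split_ifs <;> simp

lemma NoisyComputation.norm_interaction_le (M : NoisyComputation Q Loc 𝓑)
    {W : ℝ → Joint Q 𝓑 →L[ℂ] Joint Q 𝓑} (hW : ∀ t, W t ∈ unitary (Joint Q 𝓑 →L[ℂ] Joint Q 𝓑))
    (S : Finset Q) (t : ℝ) : ‖M.interaction W S t‖ ≤ ‖M.coupling S t‖ := by
  calc ‖M.interaction W S t‖
      ≤ ‖ContinuousLinearMap.adjoint (W t)‖ * (‖M.coupling S t‖ * ‖W t‖) :=
        (ContinuousLinearMap.opNorm_comp_le _ _).trans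
          (mul_le_mul_of_nonneg_left (ContinuousLinearMap.opNorm_comp_le _ _) (norm_nonneg _))
    _ ≤ 1 * (‖M.coupling S t‖ * 1) := by
        rw [LinearIsometryEquiv.norm_map]
        have := norm_le_one_of_mem_unitary (hW t)
        gcongr
    _ = _ := by ring

open scoped Classical in
/-- The coupling terms in the interaction picture during `[0, T]`, marked with the locations in `I`
that they strike. -/
def NoisyComputation.markedFamily (M : NoisyComputation Q Loc 𝓑)
    {W : ℝ → Joint Q 𝓑 →L[ℂ] Joint Q 𝓑} (hW : ∀ t, W t ∈ unitary (Joint Q 𝓑 →L[ℂ] Joint Q 𝓑))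
    (hWc : ∀ ψ, Continuous fun t => W t ψ) {b : ℝ} (hb0 : 0 ≤ b)
    (hb : ∀ S : Finset Q, S.Nonempty → ∀ t ∈ Set.Icc 0 M.T, ‖M.coupling S t‖ ≤ b)
    (I : Finset Loc) :
    MarkedFamily {S : Finset Q // S.Nonempty} I (Joint Q 𝓑) where
  -- The coupling is bounded only on `[0, T]`, while a marked family needs a bound at all times. The
  -- cutoff changes nothing at the insertion times.
  op S s := (Set.Icc 0 M.T).indicator (fun s => (-Complex.I) • M.interaction W S s) s
  mark S s := (Finset.univ.filter fun ℓ : I => s ∈ Set.Ico (M.startTime ℓ) (M.endTime ℓ)).filter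
    fun ℓ => ∃ q ∈ M.qubits ℓ, q ∈ S.1
  bound := b
  op_measurable S ψ := by
    have h : StronglyMeasurable fun s => M.interaction W S s ψ :=
      stronglyMeasurable_clm_apply
        (fun v => (continuous_adjoint_of_mem_unitary hW hWc v).stronglyMeasurable)
        (stronglyMeasurable_clm_apply (fun v => M.coupling_measurable S v)
          (hWc ψ).stronglyMeasurable)
    have h2 := (h.const_smul (-Complex.I)).indicator (measurableSet_Icc (a := 0) (b := M.T))
    have h3 : (fun s => (Set.Icc 0 M.T).indicator
        (fun s => (-Complex.I) • M.interaction W S s) s ψ) =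
        (Set.Icc 0 M.T).indicator ((-Complex.I) • fun s => M.interaction W S s ψ) := by
      funext s
      by_cases hs : s ∈ Set.Icc 0 M.T
      · simp only [Set.indicator_of_mem hs]
        rfl
      · simp only [Set.indicator_of_notMem hs]
        rfl
    rw [h3]
    exact h2
  norm_op_le S s := by
    by_cases hs : s ∈ Set.Icc 0 M.T
    · rw [Set.indicator_of_mem hs, norm_smul, norm_neg, Complex.norm_I, one_mul]
      exact (M.norm_interaction_le hW S s).trans (hb S.1 S.2 s hs)
    · rwa [Set.indicator_of_notMem hs, norm_zero]
  mark_measurable S ℓ := by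
    by_cases h : ∃ q ∈ M.qubits ℓ, q ∈ S.1
    · simp only [Finset.mem_filter, Finset.mem_univ, true_and, h, and_true]
      exact measurableSet_Ico
    · simp [h]

section

variable (M : NoisyComputation Q Loc 𝓑)
  {W : ℝ → Joint Q 𝓑 →L[ℂ] Joint Q 𝓑} (hW : ∀ t, W t ∈ unitary (Joint Q 𝓑 →L[ℂ] Joint Q 𝓑))
  (hWc : ∀ ψ, Continuous fun t => W t ψ) {b : ℝ} (hb0 : 0 ≤ b)
  (hb : ∀ S : Finset Q, S.Nonempty → ∀ t ∈ Set.Icc 0 M.T, ‖M.coupling S t‖ ≤ b)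
  (I : Finset Loc)

/-- The label type is `I` itself, so full label set means that each location of `I` has been struck;
locations outside `I` are not tracked. -/
lemma NoisyComputation.faultyTimes_eq_region [DecidableEq I] {n : ℕ}
    (S : Fin n → {S : Finset Q // S.Nonempty}) :
    M.faultyTimes I S = (M.markedFamily hW hWc hb0 hb I).region S Finset.univ M.T := by
  ext p
  simp only [Circuit.faultyTimes, Circuit.orderedTimes, MarkedFamily.region, Set.mem_ofPred_eq]
  refine and_congr_right fun _ => ?_
  rw [Finset.eq_univ_iff_forall, Subtype.forall]
  refine forall₂_congr fun ℓ hℓ => ?_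
  simp [Circuit.IsFaulty, MarkedFamily.marks, NoisyComputation.markedFamily]

lemma NoisyComputation.insertions_apply_eq [DecidableEq I] {n : ℕ}
    (S : Fin n → {S : Finset Q // S.Nonempty}) {p : Fin n → ℝ} (hp : p ∈ M.faultyTimes I S)
    (ψ : Joint Q 𝓑) :
    M.insertions W S p ψ = W M.T ((M.markedFamily hW hWc hb0 hb I).product S p ψ) := by
  have h : ∀ j, (M.markedFamily hW hWc hb0 hb I).op (S j) (p j) =
      (-Complex.I) • M.interaction W (S j) (p j) := fun j =>
    Set.indicator_of_mem (hp.1.2 j) fun s => (-Complex.I) • M.interaction W (S j) s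
  simp only [NoisyComputation.insertions, MarkedFamily.product, h]
  rfl

lemma NoisyComputation.isFaultSum [DecidableEq I] (hT : 0 ≤ M.T) {E : Joint Q 𝓑 →L[ℂ] Joint Q 𝓑}
    (hE : ∀ ψ, E ψ = (M.markedFamily hW hWc hb0 hb I).evolution ψ Finset.univ M.T) :
    M.IsFaultSum W I (W M.T * E) := by
  set X := M.markedFamily hW hWc hb0 hb I with hX
  have hR : ∀ (n : ℕ) (S : Fin n → {S : Finset Q // S.Nonempty}),
      M.faultyTimes I S = X.region S Finset.univ M.T := fun n S =>
    M.faultyTimes_eq_region hW hWc hb0 hb I S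
  have hm : ∀ (n : ℕ) (S : Fin n → {S : Finset Q // S.Nonempty}),
      MeasurableSet (M.faultyTimes I S) := fun n S => by
    rw [hR]; exact X.measurableSet_region S _ _
  have hEq : ∀ (n : ℕ) (S : Fin n → {S : Finset Q // S.Nonempty}) (ψ : Joint Q 𝓑),
      Set.EqOn (fun p => M.insertions W S p ψ) (fun p => W M.T (X.product S p ψ))
        (M.faultyTimes I S) := fun n S ψ p hp => M.insertions_apply_eq hW hWc hb0 hb I S hp ψ
  have hi : ∀ (n : ℕ) (S : Fin n → {S : Finset Q // S.Nonempty}) (ψ : Joint Q 𝓑),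
      IntegrableOn (fun p => X.product S p ψ) (M.faultyTimes I S) := fun n S ψ => by
    rw [hR]; exact X.integrableOn_product S _ _ ψ
  constructor
  · intro n S ψ
    exact (integrableOn_congr_fun (hEq n S ψ) (hm n S)).2
      ((W M.T).integrable_comp (hi n S ψ))
  · intro ψ
    have h := (W M.T).hasSum (X.hasSum_dyson ψ Finset.univ hT)
    rw [← hE] at h
    change HasSum _ (W M.T (E ψ))
    convert h using 1
    funext n
    rw [X.dyson_eq_sum_term ψ n Finset.univ hT, map_sum]
    refine Finset.sum_congr rfl fun S _ => ?_
    rw [setIntegral_congr_fun (hm n S) (hEq n S ψ), (W M.T).integral_comp_comm (hi n S ψ), hR]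
    rfl

end

end Noise

/-! ### The bound for the noisy computation. -/

variable {Q Loc 𝓑 : Type*} [Fintype Q] [DecidableEq Q]
  [NormedAddCommGroup 𝓑] [InnerProductSpace ℂ 𝓑] [CompleteSpace 𝓑]

/-- The strict inequality `2mα < c` keeps `c` positive even when `mα = 0`, so that the weights `c⁻¹
^ |B|` make sense. -/
lemma NoisyComputation.norm_evolution_markedFamily_le [Fintype Loc] [Nonempty Loc]
    (M : NoisyComputation Q Loc 𝓑)
    {W : ℝ → Joint Q 𝓑 →L[ℂ] Joint Q 𝓑} (hW : ∀ t, W t ∈ unitary (Joint Q 𝓑 →L[ℂ] Joint Q 𝓑))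
    (hWc : ∀ ψ, Continuous fun t => W t ψ) {b : ℝ} (hb0 : 0 ≤ b)
    (hb : ∀ S : Finset Q, S.Nonempty → ∀ t ∈ Set.Icc 0 M.T, ‖M.coupling S t‖ ≤ b)
    (I : Finset Loc) [DecidableEq I]
    {m : ℕ} (hm : ∀ ℓ, (M.qubits ℓ).card ≤ m)
    {α : ℝ} (hα : 0 ≤ α) {f : ℕ → ℝ} (hf : ∀ k, 1 ≤ k → 0 ≤ f k)
    (hstrength : ∀ k, 1 ≤ k → M.strength k ≤ ENNReal.ofReal (f k * α ^ k))
    (hg : ∀ k, 1 ≤ k → Summable (gTerm f α k))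
    (hsum : Summable fun k : ℕ => g f α (k + 1) / (2 * ((k + 1).factorial : ℝ)))
    {c : ℝ} (hc : 2 * m * α < c) (ψ : Joint Q 𝓑) :
    ‖(M.markedFamily hW hWc hb0 hb I).evolution ψ Finset.univ M.T‖ ≤
      (c * Real.exp (∑' k : ℕ, g f α (k + 1) / (2 * ((k + 1).factorial : ℝ)))) ^ I.card * ‖ψ‖ := by
  classical
  set X := M.markedFamily hW hWc hb0 hb I with hX
  set κ : ℝ := ∑' k : ℕ, g f α (k + 1) / (2 * ((k + 1).factorial : ℝ)) with hκ
  have hc0 : 0 < c := lt_of_le_of_lt (by positivity) hc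
  have hT := M.T_nonneg
  have ht₀ := M.maxDuration_pos
  have hκ0 : 0 ≤ κ := tsum_nonneg fun k => by
    have : 0 ≤ g f α (k + 1) := tsum_nonneg (gTerm_nonneg hα hf (by omega))
    positivity
  -- Each location in progress contributes `κ / t₀` to the growth rate, hence at most `κ` over its
  -- whole duration.
  set C := κ / M.maxDuration with hC
  have hC0 : 0 ≤ C := div_nonneg hκ0 ht₀.le
  set γ : ℝ → ℝ := fun s =>
    ∑ ℓ : I, (Set.Ico (M.startTime ℓ) (M.endTime ℓ)).indicator (fun _ => C) s with hγ
  have hskew : ∀ i s v, (⟪v, X.op i s v⟫_ℂ).re = 0 := by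
    intro S s v
    by_cases hs : s ∈ Set.Icc 0 M.T
    · have : X.op S s = (-Complex.I) • M.interaction W S s :=
        Set.indicator_of_mem hs fun s => (-Complex.I) • M.interaction W S s
      rw [this]
      exact re_inner_neg_I_smul_conj (W s) (M.coupling_selfAdjoint S s) v
    · have : X.op S s = 0 :=
        Set.indicator_of_notMem hs fun s => (-Complex.I) • M.interaction W S s
      simp [this]
  have hγint : ∫ s in (0 : ℝ)..M.T, γ s ≤ I.card * κ := by
    rw [hγ, intervalIntegral.integral_finsetSum fun ℓ _ => intervalIntegrable_indicator_Ico _ _ _ _ _]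
    calc _ ≤ ∑ _ℓ : I, κ := by
          refine Finset.sum_le_sum fun ℓ _ => ?_
          refine (integral_indicator_Ico_le (M.startTime_lt_endTime ℓ).le hC0 hT).trans ?_
          refine (mul_le_mul_of_nonneg_right (M.duration_le ℓ) hC0).trans (le_of_eq ?_)
          rw [hC, mul_div_cancel₀ _ ht₀.ne']
      _ = _ := by simp
  have hweight : ∀ s ∈ Set.Icc 0 M.T,
      ∑ i, ‖X.op i s‖ * ∑ B ∈ (X.mark i s).powerset.erase ∅, c⁻¹ ^ B.card ≤ γ s := by
    intro s hs
    set active : Finset I :=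
      Finset.univ.filter fun ℓ : I => s ∈ Set.Ico (M.startTime ℓ) (M.endTime ℓ) with hact
    have hγs : γ s = active.card * C := by
      simp only [hγ, Set.indicator_apply]
      rw [← Finset.sum_filter, Finset.sum_const, nsmul_eq_mul]
    rw [hγs]
    have hle := sum_mul_sum_powerset_le (h := fun S => ‖M.coupling S s‖) (fun _ => norm_nonneg _)
      active (fun ℓ => M.qubits ℓ) (fun ℓ hℓ ℓ' hℓ' hne => by
        by_contra hd
        exact Set.disjoint_left.1 (M.disjoint ℓ ℓ' (fun h => hne (Subtype.ext h)) hd)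
          (Finset.mem_filter.1 hℓ).2 (Finset.mem_filter.1 hℓ').2)
      (fun ℓ => hm ℓ) ht₀ hα (inv_nonneg.2 hc0.le)
      (by rw [← div_eq_mul_inv, div_le_one hc0]; exact hc.le) hf hg hsum
      (fun q j => M.factorial_mul_sum_norm_coupling_le
        (mul_nonneg (hf _ (by omega)) (by positivity)) ht₀.le (hstrength (j + 1) (by omega)) q hs)
    refine le_trans ?_ hle
    calc _ ≤ ∑ S : {S : Finset Q // S.Nonempty}, ‖M.coupling S s‖ *
          ∑ B ∈ (active.filter fun ℓ => ∃ q ∈ M.qubits ℓ.1, q ∈ S.1).powerset.erase ∅,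
            c⁻¹ ^ B.card := by
          refine Finset.sum_le_sum fun S _ => ?_
          have h1 : X.op S s = (-Complex.I) • M.interaction W S s :=
            Set.indicator_of_mem hs fun s => (-Complex.I) • M.interaction W S s
          have h2 : X.mark S s = active.filter fun ℓ => ∃ q ∈ M.qubits ℓ.1, q ∈ S.1 := by
            ext ℓ
            simp [hX, NoisyComputation.markedFamily, hact]
          rw [h1, h2, norm_smul, norm_neg, Complex.norm_I, one_mul]
          refine mul_le_mul_of_nonneg_right (M.norm_interaction_le hW S s) ?_
          exact Finset.sum_nonneg fun _ _ => by positivity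
      _ = ∑ S with S.Nonempty, ‖M.coupling S s‖ *
          ∑ B ∈ (active.filter fun ℓ => ∃ q ∈ M.qubits ℓ.1, q ∈ S).powerset.erase ∅,
            c⁻¹ ^ B.card :=
          (Finset.sum_subtype _ (by simp) fun S => ‖M.coupling S s‖ *
            ∑ B ∈ (active.filter fun ℓ => ∃ q ∈ M.qubits ℓ.1, q ∈ S).powerset.erase ∅,
              c⁻¹ ^ B.card).symm
      _ ≤ _ := Finset.sum_le_sum_of_subset_of_nonneg (Finset.filter_subset _ _) fun S _ _ =>
          mul_nonneg (norm_nonneg _) (Finset.sum_nonneg fun _ _ => by positivity)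
  refine (X.norm_evolution_le hskew hc0 (γ := γ) ?_ ?_ ?_ ?_ hweight ψ Finset.univ hT).trans ?_
  · exact fun s => tendsto_finsetSum _ fun ℓ _ => continuousWithinAt_indicator_Ico _ _ _ _
  · exact Finset.measurable_fun_sum _ fun ℓ _ => measurable_const.indicator measurableSet_Ico
  · exact fun s => Finset.sum_nonneg fun ℓ _ => Set.indicator_nonneg (fun _ _ => hC0) s
  · intro u v
    have h := IntervalIntegrable.sum (μ := volume) (a := u) (b := v) Finset.univ
      (f := fun ℓ : I => (Set.Ico (M.startTime ℓ) (M.endTime ℓ)).indicator fun _ => C)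
      fun ℓ _ => intervalIntegrable_indicator_Ico _ _ _ _ _
    rwa [Finset.sum_fn] at h
  · rw [Finset.card_univ, Fintype.card_coe, mul_pow, ← Real.exp_nat_mul]
    gcongr

/-- Each single term is dominated by the strength sum at any of its qubits, and only finitely many
sizes `|S|` occur. This uniform bound is what makes the perturbation series converge. -/
lemma NoisyComputation.exists_norm_coupling_le [Fintype Loc] [Nonempty Loc]
    (M : NoisyComputation Q Loc 𝓑) {r : ℕ → ℝ} (hr : ∀ k, 0 ≤ r (k + 1))
    (hstrength : ∀ k, 1 ≤ k → M.strength k ≤ ENNReal.ofReal (r k)) :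
    ∃ b : ℝ, 0 ≤ b ∧
      ∀ S : Finset Q, S.Nonempty → ∀ t ∈ Set.Icc 0 M.T, ‖M.coupling S t‖ ≤ b := by
  have ht₀ := M.maxDuration_pos
  have hr' : ∀ j, 0 ≤ r (j + 1) / M.maxDuration := fun j => div_nonneg (hr j) ht₀.le
  refine ⟨∑ j ∈ Finset.range (Fintype.card Q), r (j + 1) / M.maxDuration,
    Finset.sum_nonneg fun j _ => hr' j, fun S hS t ht => ?_⟩
  obtain ⟨q, hq⟩ := hS
  have hpos : 0 < S.card := Finset.card_pos.2 ⟨q, hq⟩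
  have hle := Finset.card_le_univ S
  have h := M.factorial_mul_sum_norm_coupling_le (hr (S.card - 1)) ht₀.le
    (hstrength (S.card - 1 + 1) (by omega)) q ht
  refine le_trans ?_ (Finset.single_le_sum (f := fun j => r (j + 1) / M.maxDuration)
    (fun j _ => hr' j) (Finset.mem_range.2 (by omega : S.card - 1 < Fintype.card Q)))
  rw [le_div_iff₀ ht₀]
  refine le_trans (mul_le_mul_of_nonneg_right ?_ ht₀.le) h
  have hs : ‖M.coupling S t‖ ≤
      ∑ S' with q ∈ S' ∧ S'.card = S.card - 1 + 1, ‖M.coupling S' t‖ :=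
    Finset.single_le_sum (f := fun S' => ‖M.coupling S' t‖) (fun _ _ => norm_nonneg _)
      (Finset.mem_filter.2 ⟨Finset.mem_univ _, hq, by omega⟩)
  refine hs.trans (le_mul_of_one_le_left (Finset.sum_nonneg fun _ _ => norm_nonneg _) ?_)
  exact_mod_cast Nat.one_le_iff_ne_zero.2 (Nat.factorial_ne_zero _)

end CorrelatedNoise

end

theorem theorem1 {Q Loc 𝓑 : Type*} [Fintype Q] [DecidableEq Q] [Fintype Loc] [Nonempty Loc]
    [NormedAddCommGroup 𝓑] [InnerProductSpace ℂ 𝓑] [CompleteSpace 𝓑]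
    (M : CorrelatedNoise.NoisyComputation Q Loc 𝓑)
    (U : ℝ → Matrix (CorrelatedNoise.Bits Q) (CorrelatedNoise.Bits Q) ℂ)
    (hU : CorrelatedNoise.IsSystemEvolution M.hamiltonian U)
    (V : ℝ → 𝓑 →L[ℂ] 𝓑)
    (hV : CorrelatedNoise.IsBathEvolution M.bath V)
    (m : ℕ) (hm : ∀ ℓ, (M.qubits ℓ).card ≤ m)
    (α : ℝ) (hα : 0 ≤ α) (f : ℕ → ℝ) (hf : ∀ k, 1 ≤ k → 0 ≤ f k)
    (hstrength : ∀ k, 1 ≤ k → M.strength k ≤ ENNReal.ofReal (f k * α ^ k))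
    (hg : ∀ k, 1 ≤ k → Summable (CorrelatedNoise.gTerm f α k))
    (hsum : Summable (fun k : ℕ =>
      CorrelatedNoise.g f α (k + 1) / (2 * ((k + 1).factorial : ℝ)))) :
    M.HasEffectiveNoiseStrength (CorrelatedNoise.freeEvolution U V)
      (2 * m * α * Real.exp (∑' k : ℕ,
        CorrelatedNoise.g f α (k + 1) / (2 * ((k + 1).factorial : ℝ)))) := by
  classical
  intro I
  set W := CorrelatedNoise.freeEvolution U V
  have hW : ∀ t, W t ∈ unitary _ := fun t =>
    CorrelatedNoise.freeEvolution_mem_unitary (hU.unitary t) (hV.unitary t)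
  have hWc : ∀ ψ, Continuous fun t => W t ψ :=
    CorrelatedNoise.continuous_freeEvolution hU.continuous hV.continuous
  obtain ⟨b, hb0, hb⟩ := M.exists_norm_coupling_le (r := fun k => f k * α ^ k)
    (fun k => mul_nonneg (hf _ (by omega)) (by positivity)) hstrength
  set κ : ℝ := ∑' k : ℕ, CorrelatedNoise.g f α (k + 1) / (2 * ((k + 1).factorial : ℝ))
  have hle : ∀ c, 2 * m * α < c → ∀ ψ,
      ‖(M.markedFamily hW hWc hb0 hb I).evolutionLinear Finset.univ M.T_nonneg ψ‖ ≤
        (c * Real.exp κ) ^ I.card * ‖ψ‖ := fun c hc ψ =>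
    M.norm_evolution_markedFamily_le hW hWc hb0 hb I hm hα hf hstrength hg hsum hc ψ
  -- Any admissible `c` serves to show boundedness. The operator does not depend on this choice, so
  -- `hnorm` can afterwards vary `c`.
  set E := LinearMap.mkContinuous _ _ (hle _ (lt_add_one _)) with hE
  refine ⟨W M.T * E, M.isFaultSum hW hWc hb0 hb I M.T_nonneg fun ψ => rfl, ?_⟩
  have hnorm : ∀ c, 2 * m * α < c → ‖W M.T * E‖ ≤ (c * Real.exp κ) ^ I.card := by
    intro c hc
    have hc0 : 0 ≤ c := le_trans (by positivity) hc.le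
    have h1 : ‖E‖ ≤ (c * Real.exp κ) ^ I.card :=
      E.opNorm_le_bound (by positivity) (hle c hc)
    have h2 := CorrelatedNoise.norm_le_one_of_mem_unitary (hW M.T)
    calc _ ≤ ‖W M.T‖ * ‖E‖ := norm_mul_le _ _
      _ ≤ 1 * (c * Real.exp κ) ^ I.card := by gcongr
      _ = _ := one_mul _
  -- The endpoint `c = 2mα`, possibly zero, is reached by letting `c` decrease to it.
  have hlim : Filter.Tendsto (fun c : ℝ => (c * Real.exp κ) ^ I.card)
      (nhdsWithin (2 * m * α) (Set.Ioi (2 * m * α)))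
      (nhds ((2 * m * α * Real.exp κ) ^ I.card)) :=
    (Continuous.tendsto (by fun_prop) _).mono_left nhdsWithin_le_nhds
  exact ge_of_tendsto hlim (by filter_upwards [self_mem_nhdsWithin] with c hc using hnorm c hc)
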